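/- Fix $\rho\in(0,1)$ and let $X=(X_1,X_2)$ be a zero mean bivariate Gaussian vector with covariance matrix $\begin{bmatrix}1&\rho\\ \rho&1\end{bmatrix}$. All logarithms are to base $2$ and all information quantities are measured in bits. For $D>0$ and $C\ge 0$ define the following quantities. * The Gaussian rate-distortion-cache function $$R_G((D,D),C)=\inf_{(U,\hat X_1,\hat X_2)}\ \max_{\ell\in\{1,2\}} I(X_\ell;\hat X_\ell\mid U),$$ where the infimum is over all real tuples $(U,\hat X_1,\hat X_2)$ jointly distributed with $X$ ($U$ may have any finite number of real components) such that $I(X_1,X_2;U)\le C$ and $E[(X_\ell-\hat X_\ell)^2]\le D$ for $\ell=1,2$. * The joint rate-distortion function $$R_{G,X_1X_2}(D,D)=\inf\ I(X_1,X_2;\hat X_1,\hat X_2),$$ where the infimum is over all real pairs $(\hat X_1,\hat X_2)$ jointly distributed with $X$ such that $E[(X_\ell-\hat X_\ell)^2]\le D$ for $\ell=1,2$. * The Wyner common information $$K_W(X_1,X_2)=\inf\ I(X_1,X_2;U),$$ where the infimum is over all real tuples $U$ jointly distributed with $X$ such that $X_1$ and $X_2$ are conditionally independent given $U$. Define the regions,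 for $D>0$ and $C\ge0$, $$S_1=\{(D,C): C\ge R_{G,X_1X_2}(D,D)\},\qquad S_2=\{(D,C): K_W(X_1,X_2)\le C\le R_{G,X_1X_2}(D,D)\},$$ $$S_3=\{(D,C): D\le 1-\rho,\ C\le K_W(X_1,X_2)\},\qquad S_4=\{(D,C): 1-\rho\le D\le 1,\ C\le R_{G,X_1X_2}(D,D)\}.$$ Theorem. For all $D>0$ and $C\ge 0$: $$R_G((D,D),C)=0\quad\text{if }(D,C)\in S_1,$$ $$R_G((D,D),C)=\frac14\log\frac{1-\rho^2}{D^2}-\frac C2\quad\text{if }(D,C)\in S_2,$$ $$R_G((D,D),C)\le\frac12\log\frac{1-\frac12(1+\rho)\left(1-2^{-2C}\right)}{D}\quad\text{if }(D,C)\in S_3\cup S_4.$$ -/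

import Mathlib

open MeasureTheory ProbabilityTheory InformationTheory
open scoped ENNReal NNReal

noncomputable section

namespace RDC

variable {Ω α β γ ι : Type*} [MeasurableSpace Ω]
  [MeasurableSpace α] [MeasurableSpace β] [MeasurableSpace γ]

/-- Mutual information `I(A; B)` in bits, for random variables `A`, `B` on `(Ω, P)`: the
Kullback-Leibler divergence of the joint law from the product of the marginal laws (natural
logarithm), divided by `log 2`. -/
def mutualInfo (P : Measure Ω) (A : Ω → α) (B : Ω → β) : ℝ≥0∞ :=
  klDiv (P.map fun ω => (A ω, B ω)) ((P.map A).prod (P.map B)) / ENNReal.ofReal (Real.log 2)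

/-- Conditional mutual information `I(A; B | U)` in bits: the Kullback-Leibler divergence of
`P_{U A B}` from `P_U ⊗ (P_{A | U} × P_{B | U})`, the law under which `U`, `(U, A)` and `(U, B)`
keep their distributions while `A` and `B` are conditionally independent given `U`. -/
def condMutualInfo [StandardBorelSpace α] [Nonempty α] [StandardBorelSpace β] [Nonempty β]
    (P : Measure Ω) [IsFiniteMeasure P] (A : Ω → α) (B : Ω → β) (U : Ω → γ) : ℝ≥0∞ :=
  klDiv (P.map fun ω => (U ω, (A ω, B ω)))
      ((P.map U).compProd ((condDistrib A U P).prod (condDistrib B U P))) /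
    ENNReal.ofReal (Real.log 2)

/-- The expected squared error `E[(A - B)²]` of two real random variables (possibly infinite). -/
def meanSqError (P : Measure Ω) (A B : Ω → ℝ) : ℝ≥0∞ :=
  ∫⁻ ω, ENNReal.ofReal ((A ω - B ω) ^ 2) ∂P

/-- The informational rate-distortion-cache function, in bits, of a real random vector `X` with
law `μ`, under squared error: the infimum of `max_ℓ I(X_ℓ; X̂_ℓ | U)` over all real tuples
`(U, X̂)` jointly distributed with `X` such that `I(X; U) ≤ C` and `E[(X_ℓ - X̂_ℓ)²] ≤ D_ℓ`
for all `ℓ`. The variable `P` is the joint law of `(X, U, X̂)`, and `U` has any finite number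
of real components. -/
def rdcFunction [Fintype ι] (μ : Measure (EuclideanSpace ℝ ι)) (D : ι → ℝ≥0) (C : ℝ≥0) : ℝ≥0∞ :=
  ⨅ (k : ℕ) (P : Measure (EuclideanSpace ℝ ι × (Fin k → ℝ) × EuclideanSpace ℝ ι))
    (_ : IsProbabilityMeasure P)
    (_ : P.map (fun ω => ω.1) = μ)
    (_ : mutualInfo P (fun ω => ω.1) (fun ω => ω.2.1) ≤ C)
    (_ : ∀ l, meanSqError P (fun ω => ω.1 l) (fun ω => ω.2.2 l) ≤ D l),
    ⨆ l, condMutualInfo P (fun ω => ω.1 l) (fun ω => ω.2.2 l) (fun ω => ω.2.1)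

/-- The joint rate-distortion function, in bits, of a real random vector `X` with law `μ`, under
squared error: the infimum of `I(X; X̂)` over all real vectors `X̂` jointly distributed with `X`
such that `E[(X_ℓ - X̂_ℓ)²] ≤ D_ℓ` for all `ℓ`. -/
def jointRD [Fintype ι] (μ : Measure (EuclideanSpace ℝ ι)) (D : ι → ℝ≥0) : ℝ≥0∞ :=
  ⨅ (P : Measure (EuclideanSpace ℝ ι × EuclideanSpace ℝ ι))
    (_ : P.map (fun ω => ω.1) = μ)
    (_ : ∀ l, meanSqError P (fun ω => ω.1 l) (fun ω => ω.2 l) ≤ D l),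
    mutualInfo P (fun ω => ω.1) (fun ω => ω.2)

/-- Wyner's common information, in bits, of a real random pair `X = (X_1, X_2)` with law `μ`: the
infimum of `I(X; U)` over all real tuples `U` jointly distributed with `X` such that
`X_1 - U - X_2` is a Markov chain. -/
def wynerCI (μ : Measure (EuclideanSpace ℝ (Fin 2))) : ℝ≥0∞ :=
  ⨅ (k : ℕ) (P : Measure (EuclideanSpace ℝ (Fin 2) × (Fin k → ℝ)))
    (_ : IsProbabilityMeasure P)
    (_ : P.map (fun ω => ω.1) = μ)
    (_ : CondIndepFun (MeasurableSpace.comap (fun ω => ω.2) inferInstance)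
      measurable_snd.comap_le (fun ω => ω.1 0) (fun ω => ω.1 1) P),
    mutualInfo P (fun ω => ω.1) (fun ω => ω.2)

/-- The zero mean bivariate Gaussian law with unit variances and correlation `ρ`. -/
def bivariateGaussian (ρ : ℝ) : Measure (EuclideanSpace ℝ (Fin 2)) :=
  multivariateGaussian 0 !![1, ρ; ρ, 1]

/-- Distortion-cache pairs with `R_{X₁X₂}(D, D) ≤ C`. -/
def regionS1 (ρ : ℝ) : Set (ℝ≥0 × ℝ≥0) :=
  {(D, C) | jointRD (bivariateGaussian ρ) (fun _ => D) ≤ C}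

/-- Distortion-cache pairs with `K_W(X₁, X₂) ≤ C ≤ R_{X₁X₂}(D, D)`. -/
def regionS2 (ρ : ℝ) : Set (ℝ≥0 × ℝ≥0) :=
  {(D, C) | wynerCI (bivariateGaussian ρ) ≤ C ∧
    (C : ℝ≥0∞) ≤ jointRD (bivariateGaussian ρ) (fun _ => D)}

/-- Distortion-cache pairs with `D ≤ 1 - ρ` and `C ≤ K_W(X₁, X₂)`. -/
def regionS3 (ρ : ℝ) : Set (ℝ≥0 × ℝ≥0) :=
  {(D, C) | (D : ℝ) ≤ 1 - ρ ∧ (C : ℝ≥0∞) ≤ wynerCI (bivariateGaussian ρ)}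

/-- Distortion-cache pairs with `1 - ρ ≤ D ≤ 1` and `C ≤ R_{X₁X₂}(D, D)`. -/
def regionS4 (ρ : ℝ) : Set (ℝ≥0 × ℝ≥0) :=
  {(D, C) | 1 - ρ ≤ (D : ℝ) ∧ (D : ℝ) ≤ 1 ∧
    (C : ℝ≥0∞) ≤ jointRD (bivariateGaussian ρ) (fun _ => D)}

end RDC

end

/-! In the orthonormal sum and difference coordinates, `X` has independent components of variances
`1 + ρ` and `1 - ρ`. Every channel used here adds independent Gaussian noise in these coordinates,
so every achievable rate is explicit. All lower bounds come from one inequality: a test function `h`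
with `∫ h dν ≤ 1` bounds the divergence from `ν` below (`ofReal_integral_le_klDiv`). The test
functions are Gaussian likelihood ratios, multiplied by Radon-Nikodym derivatives where needed.

Upper bounds. Cache a Gaussian description of `X` that leaves error variances `k`, `l` in the
rotated coordinates. This costs `log ((1 - ρ²) / (k l)) / 2` bits and leaves each `X_ℓ` with
conditional variance `(k + l) / 2`. A refinement to distortion `E` then costs `log ((k + l) / (2 E))
/ 2` per user (`rdcFunction_le`). Spending the cache on the sum component alone, `k = (1 + ρ)
2^(-2C)` and `l = 1 - ρ`, gives the bound on `S₃ ∪ S₄`. The choice `k = l` gives the value on `S₂`.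

Lower bound. With `A = X_ℓ`, one has `I(X_ℓ; X̂_ℓ | U) ≥ log (1 / D) / 2 - I(X_ℓ; U)`
(`ofReal_le_klDiv_cond`). Also `I(X₁; U) + I(X₂; U) ≤ I(X; U) + I(X₁; X₂)`, which is at most `C +
I(X₁; X₂)` (`ofReal_le_klDiv_add`). Bounding the maximum over the users by the average gives
`ofReal_le_rdcFunction`.

The regions are made explicit by two-sided bounds on `jointRD` and `wynerCI`. The lower bounds come
from `ofReal_le_klDiv_of_sqError_le`; for `wynerCI` the estimator is the conditional mean given `U`.
The bounds on `jointRD` follow reverse water-filling: both components carry noise `D` when `D ≤ 1 -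
ρ`, and the weak one gets no rate when `1 - ρ ≤ D ≤ 1`. -/

namespace RDC

/-! ### Divergence: a variational lower bound and an exact formula -/

/-- Donsker-Varadhan lower bound: a nonnegative test function with `∫ h dν ≤ 1` bounds the
Kullback-Leibler divergence below by the mean of its logarithm. -/
theorem ofReal_integral_le_klDiv {α : Type*} [MeasurableSpace α] {μ ν : Measure α}
    [IsProbabilityMeasure μ] [IsProbabilityMeasure ν] {f : α → ℝ} {h : α → ℝ≥0∞}
    (hf : Integrable f μ) (hh : Measurable h) (hfh : ∀ᵐ x ∂μ, ENNReal.ofReal (Real.exp (f x)) ≤ h x)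
    (hν : ∫⁻ x, h x ∂ν ≤ 1) :
    ENNReal.ofReal (∫ x, f x ∂μ) ≤ klDiv μ ν := by
  by_cases htop : klDiv μ ν = ∞
  · simp [htop]
  obtain ⟨hac, hint⟩ := klDiv_ne_top_iff.1 htop
  rw [klDiv_of_ac_of_integrable hac hint]
  simp only [probReal_univ, add_sub_cancel_right]
  apply ENNReal.ofReal_le_ofReal
  -- Changing measure from `μ` to `ν` produces `r * (h * r⁻¹)` with `r = dμ/dν`. This is at most `h`
  -- even where `r` is `0` or `∞`, so no equivalence of `μ` and `ν` is needed.
  have hbound : ∫⁻ x, ENNReal.ofReal (Real.exp (f x - llr μ ν x)) ∂μ ≤ 1 := by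
    calc ∫⁻ x, ENNReal.ofReal (Real.exp (f x - llr μ ν x)) ∂μ
        ≤ ∫⁻ x, h x * (μ.rnDeriv ν x)⁻¹ ∂μ := by
          apply lintegral_mono_ae
          filter_upwards [hfh, exp_llr_of_ac μ ν hac, Measure.rnDeriv_pos hac,
            hac.ae_le (Measure.rnDeriv_lt_top μ ν)] with x hx hx2 hx3 hx4
          rw [Real.exp_sub, hx2, ENNReal.ofReal_div_of_pos (ENNReal.toReal_pos hx3.ne' hx4.ne),
            ENNReal.ofReal_toReal hx4.ne, div_eq_mul_inv]
          gcongr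
      _ = ∫⁻ x, μ.rnDeriv ν x * (h x * (μ.rnDeriv ν x)⁻¹) ∂ν :=
          (lintegral_rnDeriv_mul hac
            (hh.mul (Measure.measurable_rnDeriv μ ν).inv).aemeasurable).symm
      _ ≤ ∫⁻ x, h x ∂ν := by
          gcongr with x
          rw [mul_left_comm]
          exact mul_le_of_le_one_right' (ENNReal.mul_inv_le_one _)
      _ ≤ 1 := hν
  have hmeas : AEStronglyMeasurable (fun x => Real.exp (f x - llr μ ν x)) μ :=
    Real.continuous_exp.comp_aestronglyMeasurable (hf.sub hint).aestronglyMeasurable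
  have hexp : Integrable (fun x => Real.exp (f x - llr μ ν x)) μ := by
    refine ⟨hmeas, ?_⟩
    rw [hasFiniteIntegral_iff_ofReal (ae_of_all _ fun x => (Real.exp_pos _).le)]
    exact hbound.trans_lt ENNReal.one_lt_top
  have hexp_le : ∫ x, Real.exp (f x - llr μ ν x) ∂μ ≤ 1 := by
    rw [integral_eq_lintegral_of_nonneg_ae (ae_of_all _ fun x => (Real.exp_pos _).le) hmeas]
    simpa using ENNReal.toReal_mono ENNReal.one_ne_top hbound
  -- Integrating `t ≤ exp t - 1` at `t = f - llr` replaces Jensen's inequality.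
  have hsub : ∫ x, (f x - llr μ ν x) ∂μ ≤ ∫ x, (Real.exp (f x - llr μ ν x) - 1) ∂μ :=
    integral_mono (hf.sub hint) (hexp.sub (integrable_const _)) fun x => by
      have := Real.add_one_le_exp (f x - llr μ ν x)
      simp only
      linarith
  rw [integral_sub hf hint, integral_sub hexp (integrable_const _)] at hsub
  simp only [integral_const, probReal_univ, smul_eq_mul, mul_one] at hsub
  linarith

/-- The Kullback-Leibler divergence of measures with an explicit exponential density. -/
theorem klDiv_eq_of_lintegral_eq {α : Type*} [MeasurableSpace α] {μ ν : Measure α}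
    [IsProbabilityMeasure μ] [IsProbabilityMeasure ν] {f : α → ℝ} (hf : Integrable f μ)
    (hfm : Measurable f)
    (h : ∀ F : α → ℝ≥0∞, Measurable F →
      ∫⁻ x, F x ∂μ = ∫⁻ x, ENNReal.ofReal (Real.exp (f x)) * F x ∂ν) :
    klDiv μ ν = ENNReal.ofReal (∫ x, f x ∂μ) := by
  have hd : Measurable fun x => ENNReal.ofReal (Real.exp (f x)) := by fun_prop
  have hμ : μ = ν.withDensity fun x => ENNReal.ofReal (Real.exp (f x)) := by
    refine Measure.ext_of_lintegral _ fun F hF => ?_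
    rw [h F hF, lintegral_withDensity_eq_lintegral_mul _ hd hF]
    rfl
  have hac : μ ≪ ν := hμ ▸ withDensity_absolutelyContinuous _ _
  have hllr : llr μ ν =ᵐ[μ] f := by
    have := Measure.rnDeriv_withDensity ν hd
    rw [← hμ] at this
    filter_upwards [hac.ae_le this] with x hx
    simp only [llr_def]
    rw [hx, ENNReal.toReal_ofReal (Real.exp_pos _).le, Real.log_exp]
  rw [klDiv_of_ac_of_integrable hac (hf.congr hllr.symm), integral_congr_ae hllr]
  simp

/-! ### Gaussian likelihood ratios -/

/-- The logarithm of the density of `N(m, w)` with respect to `N(m', v)`. -/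
noncomputable def gaussLogRatio (v w : ℝ) (m m' x : ℝ) : ℝ :=
  1 / 2 * Real.log (v / w) - (x - m) ^ 2 / (2 * w) + (x - m') ^ 2 / (2 * v)

@[fun_prop]
theorem measurable_gaussLogRatio {α : Type*} [MeasurableSpace α] {f g k : α → ℝ} (v w : ℝ)
    (hf : Measurable f) (hg : Measurable g) (hk : Measurable k) :
    Measurable fun x => gaussLogRatio v w (f x) (g x) (k x) := by
  unfold gaussLogRatio
  fun_prop

theorem lintegral_exp_gaussLogRatio_mul {v w : ℝ≥0} (hv : v ≠ 0) (hw : w ≠ 0) (m m' : ℝ)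
    {F : ℝ → ℝ≥0∞} (hF : Measurable F) :
    ∫⁻ x, ENNReal.ofReal (Real.exp (gaussLogRatio v w m m' x)) * F x ∂(gaussianReal m' v) =
      ∫⁻ x, F x ∂(gaussianReal m w) := by
  rw [gaussianReal_of_var_ne_zero _ hv, gaussianReal_of_var_ne_zero _ hw,
    lintegral_withDensity_eq_lintegral_mul _ (measurable_gaussianPDF _ _) (by fun_prop),
    lintegral_withDensity_eq_lintegral_mul _ (measurable_gaussianPDF _ _) hF]
  refine lintegral_congr fun x => ?_
  simp only [Pi.mul_apply, gaussianPDF]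
  rw [← mul_assoc, ← ENNReal.ofReal_mul (gaussianPDFReal_nonneg _ _ _)]
  congr 2
  have hv' : (0 : ℝ) < v := by positivity
  have hw' : (0 : ℝ) < w := by positivity
  have hs : Real.exp (1 / 2 * Real.log (v / w)) = √(v / w) := by
    rw [Real.sqrt_eq_rpow, Real.rpow_def_of_pos (by positivity), mul_comm]
  rw [gaussianPDFReal, gaussianPDFReal, gaussLogRatio, add_comm, ← add_sub_assoc, Real.exp_sub,
    Real.exp_add, hs, Real.sqrt_div hv'.le, Real.sqrt_mul (by positivity) (v : ℝ),
    Real.sqrt_mul (by positivity) (w : ℝ), neg_div, neg_div, Real.exp_neg, Real.exp_neg]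
  have h1 : √(v : ℝ) ≠ 0 := by positivity
  have h2 : √(w : ℝ) ≠ 0 := by positivity
  have h3 : √(2 * Real.pi) ≠ 0 := by positivity
  field_simp

theorem lintegral_exp_gaussLogRatio {v w : ℝ≥0} (hv : v ≠ 0) (hw : w ≠ 0) (m m' : ℝ) :
    ∫⁻ x, ENNReal.ofReal (Real.exp (gaussLogRatio v w m m' x)) ∂(gaussianReal m' v) = 1 := by
  simpa using lintegral_exp_gaussLogRatio_mul hv hw m m' (F := fun _ => 1) measurable_const

/-- With equal variances the quadratic terms cancel and the exponent is affine in `x`, so the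
integral is a moment generating function, monotone in the variance. This serves the component that
receives no rate in the reverse water-filling bound. -/
theorem lintegral_exp_gaussLogRatio_self_le {v w : ℝ≥0} (hw : w ≠ 0) (hvw : v ≤ w) (m : ℝ) :
    ∫⁻ x, ENNReal.ofReal (Real.exp (gaussLogRatio w w m 0 x)) ∂(gaussianReal 0 v) ≤ 1 := by
  have hw' : (0 : ℝ) < w := by positivity
  have hlin : ∀ x, Real.exp (gaussLogRatio w w m 0 x) =
      Real.exp (-(m ^ 2 / (2 * w))) * Real.exp (m / w * x) := fun x => by
    rw [← Real.exp_add, gaussLogRatio, div_self hw'.ne', Real.log_one]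
    congr 1
    field_simp
    ring
  simp_rw [hlin]
  rw [← ofReal_integral_eq_lintegral_ofReal
    ((integrable_exp_mul_gaussianReal (m / w)).const_mul _) (ae_of_all _ fun x => by positivity),
    integral_const_mul]
  have hm := congrFun (mgf_fun_id_gaussianReal (μ := 0) (v := v)) (m / w)
  rw [mgf] at hm
  rw [hm, ← Real.exp_add, ENNReal.ofReal_le_one, Real.exp_le_one_iff]
  have : (v : ℝ) * (m / w) ^ 2 ≤ w * (m / w) ^ 2 := by gcongr
  have h2 : (w : ℝ) * (m / w) ^ 2 = m ^ 2 / w := by field_simp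
  have h3 : m ^ 2 / (2 * w) = m ^ 2 / w / 2 := by field_simp
  rw [h3]
  linarith

theorem integrable_sq_gaussianReal (v : ℝ≥0) : Integrable (fun x => x ^ 2) (gaussianReal 0 v) :=
  (memLp_id_gaussianReal (μ := 0) (v := v) 2).integrable_sq

theorem integral_sq_gaussianReal (v : ℝ≥0) : ∫ x, x ^ 2 ∂(gaussianReal 0 v) = v := by
  have h := variance_eq_sub (memLp_id_gaussianReal (μ := 0) (v := v) 2)
  simp only [variance_id_gaussianReal, id_eq, integral_id_gaussianReal] at h
  simpa using h.symm

/-! ### Rotated coordinates -/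

/-- The orthogonal change of coordinates that diagonalises every covariance matrix with equal
variances. -/
noncomputable def rotation (p : ℝ × ℝ) : EuclideanSpace ℝ (Fin 2) :=
  !₂[(p.1 + p.2) / √2, (p.1 - p.2) / √2]

@[simp]
theorem rotation_apply_zero (p : ℝ × ℝ) : rotation p 0 = (p.1 + p.2) / √2 := rfl

@[simp]
theorem rotation_apply_one (p : ℝ × ℝ) : rotation p 1 = (p.1 - p.2) / √2 := rfl

@[fun_prop]
theorem measurable_rotation : Measurable rotation := by
  unfold rotation
  refine (WithLp.measurable_toLp 2 _).comp (measurable_pi_iff.2 fun i => ?_)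
  fin_cases i <;> simp <;> fun_prop

/-- A centred Gaussian pair with independent coordinates of variances `v` and `w`. -/
noncomputable def gaussianPair (v w : ℝ≥0) : Measure (ℝ × ℝ) :=
  (gaussianReal 0 v).prod (gaussianReal 0 w)

instance (v w : ℝ≥0) : IsProbabilityMeasure (gaussianPair v w) := by
  unfold gaussianPair
  infer_instance

theorem charFun_map_gaussianPair (v w : ℝ≥0) {L : ℝ × ℝ → EuclideanSpace ℝ (Fin 2)}
    (hL : Measurable L) {t : EuclideanSpace ℝ (Fin 2)} {a b : ℝ}
    (hab : ∀ p, inner ℝ (L p) t = p.1 * a + p.2 * b) :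
    charFun ((gaussianPair v w).map L) t =
      Complex.exp (-(v * a ^ 2 / 2 + w * b ^ 2 / 2)) := by
  rw [charFun_apply, integral_map hL.aemeasurable (by fun_prop), gaussianPair]
  have : ∀ p : ℝ × ℝ, Complex.exp ((inner ℝ (L p) t : ℝ) * Complex.I) =
      Complex.exp (inner ℝ p.1 a * Complex.I) * Complex.exp (inner ℝ p.2 b * Complex.I) := by
    intro p
    rw [← Complex.exp_add, hab]
    congr 1
    simp
    ring
  simp_rw [this]
  rw [integral_prod_mul (fun x : ℝ => Complex.exp (inner ℝ x a * Complex.I))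
    (fun x : ℝ => Complex.exp (inner ℝ x b * Complex.I)), ← charFun_apply, ← charFun_apply,
    charFun_gaussianReal, charFun_gaussianReal, ← Complex.exp_add]
  congr 1
  push_cast
  ring

theorem sq_div_sqrt_two (x : ℝ) : (x / √2) ^ 2 = x ^ 2 / 2 := by
  rw [div_pow, Real.sq_sqrt (by norm_num)]

theorem charFun_map_rotation (v w : ℝ≥0) (t : EuclideanSpace ℝ (Fin 2)) :
    charFun ((gaussianPair v w).map rotation) t =
      Complex.exp (-(v * ((t 0 + t 1 : ℝ) ^ 2 / 2 : ℝ) / 2 + w * ((t 0 - t 1) ^ 2 / 2 : ℝ) / 2)) := by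
  rw [charFun_map_gaussianPair v w measurable_rotation (a := (t 0 + t 1) / √2)
    (b := (t 0 - t 1) / √2), ← sq_div_sqrt_two, ← sq_div_sqrt_two]
  · push_cast
    rfl
  · intro p
    simp [PiLp.inner_apply, Fin.sum_univ_two]
    ring

/-- Rotation invariance of isotropic Gaussians. It allows a return to the original coordinates
whenever the two rotated variances agree, and there the two coordinates are again independent. -/
theorem map_rotation_gaussianPair_self (v : ℝ≥0) :
    (gaussianPair v v).map rotation = (gaussianPair v v).map fun p => !₂[p.1, p.2] := by
  have hm : Measurable fun p : ℝ × ℝ => !₂[p.1, p.2] := by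
    refine (WithLp.measurable_toLp 2 _).comp (measurable_pi_iff.2 fun i => ?_)
    fin_cases i <;> simp <;> fun_prop
  have := Measure.isProbabilityMeasure_map (μ := gaussianPair v v) hm.aemeasurable
  have := Measure.isProbabilityMeasure_map (μ := gaussianPair v v) measurable_rotation.aemeasurable
  refine Measure.ext_of_charFun (funext fun t => ?_)
  rw [charFun_map_rotation, charFun_map_gaussianPair v v hm (a := t 0) (b := t 1)]
  · congr 1
    push_cast
    ring
  · intro p
    simp [PiLp.inner_apply, Fin.sum_univ_two]
    ring

theorem posSemidef_of_abs_le {ρ : ℝ} (h : |ρ| ≤ 1) : (!![1, ρ; ρ, 1] : Matrix _ _ ℝ).PosSemidef := by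
  refine Matrix.PosSemidef.of_dotProduct_mulVec_nonneg ?_ fun x => ?_
  · ext i j
    fin_cases i <;> fin_cases j <;> simp
  · have h1 := abs_le.1 h
    simp [Matrix.mulVec, dotProduct, Fin.sum_univ_two]
    nlinarith [mul_nonneg (by linarith : 0 ≤ 1 - ρ) (sq_nonneg (x 0 - x 1)),
      mul_nonneg (by linarith : 0 ≤ 1 + ρ) (sq_nonneg (x 0 + x 1))]

/-- The covariance matrix has eigenvalues `1 ± ρ` with eigenvectors `(1, ±1)`; the two
characteristic functions agree. -/
theorem bivariateGaussian_eq_map_rotation {ρ : ℝ} {v w : ℝ≥0} (hv : (v : ℝ) = 1 + ρ)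
    (hw : (w : ℝ) = 1 - ρ) : bivariateGaussian ρ = (gaussianPair v w).map rotation := by
  have := Measure.isProbabilityMeasure_map (μ := gaussianPair v w) measurable_rotation.aemeasurable
  unfold bivariateGaussian
  refine Measure.ext_of_charFun (funext fun t => ?_)
  rw [charFun_map_rotation, charFun_multivariateGaussian (posSemidef_of_abs_le
    (abs_le.2 ⟨by linarith [v.coe_nonneg], by linarith [w.coe_nonneg]⟩))]
  congr 1
  have hv' : (v : ℂ) = 1 + ρ := by exact_mod_cast congrArg Complex.ofReal hv
  have hw' : (w : ℂ) = 1 - ρ := by exact_mod_cast congrArg Complex.ofReal hw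
  rw [hv', hw']
  simp [Matrix.mulVec, dotProduct, Fin.sum_univ_two]
  ring

instance (ρ : ℝ) : IsProbabilityMeasure (bivariateGaussian ρ) := by
  unfold bivariateGaussian
  infer_instance

theorem lintegral_gaussianPair_exp_mul {v w k l : ℝ≥0} (hv : v ≠ 0) (hw : w ≠ 0) (hk : k ≠ 0)
    (hl : l ≠ 0) (m n : ℝ) {F : ℝ × ℝ → ℝ≥0∞} (hF : Measurable F) :
    ∫⁻ p, ENNReal.ofReal (Real.exp (gaussLogRatio v k m 0 p.1 + gaussLogRatio w l n 0 p.2)) * F p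
        ∂(gaussianPair v w) =
      ∫⁻ p, F p ∂((gaussianReal m k).prod (gaussianReal n l)) := by
  rw [gaussianPair, lintegral_prod _ (by fun_prop), lintegral_prod _ (by fun_prop),
    ← lintegral_exp_gaussLogRatio_mul hv hk m 0 (by fun_prop)]
  refine lintegral_congr fun x => ?_
  rw [← lintegral_exp_gaussLogRatio_mul hw hl n 0 (by fun_prop),
    ← lintegral_const_mul _ (by fun_prop)]
  refine lintegral_congr fun y => ?_
  simp only [Real.exp_add]
  rw [ENNReal.ofReal_mul (Real.exp_pos _).le, mul_assoc]

theorem integrable_sq_of_lintegral_ne_top {Ω : Type*} [MeasurableSpace Ω] {P : Measure Ω}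
    {f : Ω → ℝ} (hf : Measurable f) (h : ∫⁻ ω, ENNReal.ofReal (f ω ^ 2) ∂P ≠ ∞) :
    Integrable (fun ω => f ω ^ 2) P := by
  refine ⟨by fun_prop, ?_⟩
  rw [hasFiniteIntegral_iff_ofReal (ae_of_all _ fun _ => sq_nonneg _)]
  exact h.lt_top

section Law

variable {Ω : Type*} [MeasurableSpace Ω] {P : Measure Ω} {X : Ω → EuclideanSpace ℝ (Fin 2)}
  {v w : ℝ≥0}

/-- The rotated coordinates of a vector whose law is a rotated Gaussian pair. -/
theorem map_rotatedCoord (hXm : Measurable X)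
    (hX : P.map X = (gaussianPair v w).map rotation) :
    P.map (fun ω => ((X ω 0 + X ω 1) / √2, (X ω 0 - X ω 1) / √2)) = gaussianPair v w := by
  have hg : Measurable fun x : EuclideanSpace ℝ (Fin 2) =>
      ((x 0 + x 1) / √2, (x 0 - x 1) / √2) := by fun_prop
  have : (fun ω => ((X ω 0 + X ω 1) / √2, (X ω 0 - X ω 1) / √2)) =
      (fun x : EuclideanSpace ℝ (Fin 2) => ((x 0 + x 1) / √2, (x 0 - x 1) / √2)) ∘ X := rfl
  rw [this, ← Measure.map_map hg hXm, hX, Measure.map_map hg measurable_rotation]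
  convert Measure.map_id using 2
  funext p
  have h2 : √2 ^ 2 = (2 : ℝ) := Real.sq_sqrt (by norm_num)
  have h0 : √2 ≠ 0 := by positivity
  ext
  · simp only [Function.comp, rotation_apply_zero, rotation_apply_one, id]
    field_simp
    rw [h2]
    ring
  · simp only [Function.comp, rotation_apply_zero, rotation_apply_one, id]
    field_simp
    rw [h2]
    ring

theorem map_rotatedCoord_fst (hXm : Measurable X)
    (hX : P.map X = (gaussianPair v w).map rotation) :
    P.map (fun ω => (X ω 0 + X ω 1) / √2) = gaussianReal 0 v := by
  have h := congrArg (Measure.map Prod.fst) (map_rotatedCoord hXm hX)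
  rw [Measure.map_map measurable_fst (by fun_prop), gaussianPair, Measure.map_fst_prod] at h
  simpa [Function.comp_def] using h

theorem map_rotatedCoord_snd (hXm : Measurable X)
    (hX : P.map X = (gaussianPair v w).map rotation) :
    P.map (fun ω => (X ω 0 - X ω 1) / √2) = gaussianReal 0 w := by
  have h := congrArg (Measure.map Prod.snd) (map_rotatedCoord hXm hX)
  rw [Measure.map_map measurable_snd (by fun_prop), gaussianPair, Measure.map_snd_prod] at h
  simpa [Function.comp_def] using h

end Law

/-! ### Second moments and mean log-likelihood ratios -/

section Moments

variable {Ω : Type*} [MeasurableSpace Ω] {P : Measure Ω} {A : Ω → ℝ} {v : ℝ≥0}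

theorem integrable_sq_of_map_eq (hA : Measurable A) (h : P.map A = gaussianReal 0 v) :
    Integrable (fun ω => A ω ^ 2) P := by
  have := integrable_sq_gaussianReal v
  rw [← h] at this
  exact (integrable_map_measure (f := A) (g := fun x => x ^ 2) (by fun_prop) hA.aemeasurable).1 this

theorem integral_sq_of_map_eq (hA : Measurable A) (h : P.map A = gaussianReal 0 v) :
    ∫ ω, A ω ^ 2 ∂P = v := by
  have := integral_sq_gaussianReal v
  rw [← h, integral_map hA.aemeasurable (by fun_prop)] at this
  exact this

theorem integrable_gaussLogRatio {B C : Ω → ℝ} [IsProbabilityMeasure P] (a b : ℝ)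
    (h1 : Integrable (fun ω => (A ω - B ω) ^ 2) P) (h2 : Integrable (fun ω => (A ω - C ω) ^ 2) P) :
    Integrable (fun ω => gaussLogRatio a b (B ω) (C ω) (A ω)) P := by
  unfold gaussLogRatio
  exact ((integrable_const _).sub (h1.div_const _)).add (h2.div_const _)

theorem integral_gaussLogRatio {B C : Ω → ℝ} [IsProbabilityMeasure P] (a b : ℝ)
    (h1 : Integrable (fun ω => (A ω - B ω) ^ 2) P) (h2 : Integrable (fun ω => (A ω - C ω) ^ 2) P) :
    ∫ ω, gaussLogRatio a b (B ω) (C ω) (A ω) ∂P =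
      1 / 2 * Real.log (a / b) - (∫ ω, (A ω - B ω) ^ 2 ∂P) / (2 * b) +
        (∫ ω, (A ω - C ω) ^ 2 ∂P) / (2 * a) := by
  unfold gaussLogRatio
  have h0 : Integrable (fun _ : Ω => 1 / 2 * Real.log (a / b)) P := integrable_const _
  have h01 : Integrable (fun ω => 1 / 2 * Real.log (a / b) - (A ω - B ω) ^ 2 / (2 * b)) P :=
    h0.sub (h1.div_const _)
  rw [integral_add h01 (h2.div_const _), integral_sub h0 (h1.div_const _), integral_div,
    integral_div]
  simp

end Moments

/-! ### Mutual information needed for a given squared error -/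

section Converse

variable {Ω γ : Type*} [MeasurableSpace Ω] [MeasurableSpace γ] {P : Measure Ω}
  [IsProbabilityMeasure P] {X : Ω → EuclideanSpace ℝ (Fin 2)} {U : Ω → γ} {v w : ℝ≥0}

/-- Shannon-type lower bound on the divergence defining `I(X; U)` for a Gaussian pair `X` that is
estimated from `U` with total squared error at most `2 D`. -/
theorem ofReal_le_klDiv_of_sqError_le (hXm : Measurable X) (hUm : Measurable U)
    (hX : P.map X = (gaussianPair v w).map rotation) {θ a b : ℝ≥0} (hθ : θ ≠ 0)
    (ha : ∀ m, ∫⁻ x, ENNReal.ofReal (Real.exp (gaussLogRatio a θ m 0 x)) ∂(gaussianReal 0 v) ≤ 1)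
    (hb : ∀ m, ∫⁻ x, ENNReal.ofReal (Real.exp (gaussLogRatio b θ m 0 x)) ∂(gaussianReal 0 w) ≤ 1)
    {Y Z : γ → ℝ} (hY : Measurable Y) (hZ : Measurable Z) {D : ℝ}
    (hYint : Integrable (fun ω => (X ω 0 - Y (U ω)) ^ 2) P)
    (hZint : Integrable (fun ω => (X ω 1 - Z (U ω)) ^ 2) P)
    (hD : ∫ ω, (X ω 0 - Y (U ω)) ^ 2 ∂P + ∫ ω, (X ω 1 - Z (U ω)) ^ 2 ∂P ≤ 2 * D) :
    ENNReal.ofReal (1 / 2 * Real.log (a / θ) + 1 / 2 * Real.log (b / θ) - D / θ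
        + v / (2 * a) + w / (2 * b)) ≤
      klDiv (P.map fun ω => (X ω, U ω)) ((P.map X).prod (P.map U)) := by
  have hθ' : (0 : ℝ) < θ := by positivity
  have := Measure.isProbabilityMeasure_map (μ := P) hXm.aemeasurable
  have := Measure.isProbabilityMeasure_map (μ := P) hUm.aemeasurable
  have hXU : Measurable fun ω => (X ω, U ω) := by fun_prop
  have := Measure.isProbabilityMeasure_map (μ := P) hXU.aemeasurable
  -- The test exponent is the log-likelihood ratio of the backward channel that adds noise of
  -- variance `θ` to the rotated estimates. The free parameters `a` and `b` allow a component of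
  -- variance below `θ`, for which the parameter is taken to be `θ` itself.
  set f : EuclideanSpace ℝ (Fin 2) × γ → ℝ := fun q =>
    gaussLogRatio a θ ((Y q.2 + Z q.2) / √2) 0 ((q.1 0 + q.1 1) / √2) +
      gaussLogRatio b θ ((Y q.2 - Z q.2) / √2) 0 ((q.1 0 - q.1 1) / √2) with hfdef
  have hfm : Measurable f := by fun_prop
  have hsum : ∀ ω, ((X ω 0 + X ω 1) / √2 - (Y (U ω) + Z (U ω)) / √2) ^ 2 =
      ((X ω 0 - Y (U ω)) + (X ω 1 - Z (U ω))) ^ 2 / 2 := fun ω => by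
    rw [← sq_div_sqrt_two]; ring
  have hdiff : ∀ ω, ((X ω 0 - X ω 1) / √2 - (Y (U ω) - Z (U ω)) / √2) ^ 2 =
      ((X ω 0 - Y (U ω)) - (X ω 1 - Z (U ω))) ^ 2 / 2 := fun ω => by
    rw [← sq_div_sqrt_two]; ring
  have hYL : MemLp (fun ω => X ω 0 - Y (U ω)) 2 P :=
    (memLp_two_iff_integrable_sq (by fun_prop)).2 hYint
  have hZL : MemLp (fun ω => X ω 1 - Z (U ω)) 2 P :=
    (memLp_two_iff_integrable_sq (by fun_prop)).2 hZint
  have i1 : Integrable (fun ω => ((X ω 0 + X ω 1) / √2 - (Y (U ω) + Z (U ω)) / √2) ^ 2) P := by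
    simp_rw [hsum]
    exact (hYL.add hZL).integrable_sq.div_const _
  have i2 : Integrable (fun ω => ((X ω 0 - X ω 1) / √2 - (Y (U ω) - Z (U ω)) / √2) ^ 2) P := by
    simp_rw [hdiff]
    exact (hYL.sub hZL).integrable_sq.div_const _
  have hs := map_rotatedCoord_fst hXm hX
  have hd := map_rotatedCoord_snd hXm hX
  have i3 : Integrable (fun ω => ((X ω 0 + X ω 1) / √2 - 0) ^ 2) P := by
    simpa using integrable_sq_of_map_eq (by fun_prop) hs
  have i4 : Integrable (fun ω => ((X ω 0 - X ω 1) / √2 - 0) ^ 2) P := by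
    simpa using integrable_sq_of_map_eq (by fun_prop) hd
  have hint := (integrable_gaussLogRatio a θ i1 i3).add (integrable_gaussLogRatio b θ i2 i4)
  have hval : 1 / 2 * Real.log (a / θ) + 1 / 2 * Real.log (b / θ) - D / θ
        + v / (2 * a) + w / (2 * b) ≤ ∫ q, f q ∂(P.map fun ω => (X ω, U ω)) := by
    rw [integral_map hXU.aemeasurable hfm.aestronglyMeasurable, hfdef]
    simp only
    rw [integral_add (integrable_gaussLogRatio a θ i1 i3) (integrable_gaussLogRatio b θ i2 i4),
      integral_gaussLogRatio a θ i1 i3, integral_gaussLogRatio b θ i2 i4]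
    have e3 : ∫ ω, ((X ω 0 + X ω 1) / √2 - 0) ^ 2 ∂P = (v : ℝ) := by
      simpa using integral_sq_of_map_eq (by fun_prop) hs
    have e4 : ∫ ω, ((X ω 0 - X ω 1) / √2 - 0) ^ 2 ∂P = (w : ℝ) := by
      simpa using integral_sq_of_map_eq (by fun_prop) hd
    -- The rotation is orthogonal, so the total squared error is the same in both coordinate
    -- systems.
    have e12 : ∫ ω, ((X ω 0 + X ω 1) / √2 - (Y (U ω) + Z (U ω)) / √2) ^ 2 ∂P +
        ∫ ω, ((X ω 0 - X ω 1) / √2 - (Y (U ω) - Z (U ω)) / √2) ^ 2 ∂P ≤ 2 * D := by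
      rw [← integral_add i1 i2]
      refine le_of_eq_of_le ?_ hD
      rw [← integral_add hYint hZint]
      refine integral_congr_ae (ae_of_all _ fun ω => ?_)
      simp only [hsum, hdiff]
      ring
    rw [e3, e4]
    have := div_le_div_of_nonneg_right e12 (by positivity : (0 : ℝ) ≤ 2 * θ)
    rw [add_div, mul_div_mul_left _ _ (by norm_num : (2 : ℝ) ≠ 0)] at this
    linarith
  refine (ENNReal.ofReal_le_ofReal hval).trans (ofReal_integral_le_klDiv
    (h := fun q => ENNReal.ofReal (Real.exp (f q))) ?_ (by fun_prop) (ae_of_all _ fun _ => le_rfl) ?_)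
  · exact (integrable_map_measure hfm.aestronglyMeasurable hXU.aemeasurable).2 hint
  · rw [lintegral_prod_symm _ (by fun_prop)]
    calc _ ≤ ∫⁻ _, 1 ∂(P.map U) := by
          refine lintegral_mono fun u => ?_
          have h1 : ∀ x : EuclideanSpace ℝ (Fin 2), ENNReal.ofReal (Real.exp (f (x, u))) =
              (fun p : ℝ × ℝ =>
                ENNReal.ofReal (Real.exp (gaussLogRatio a θ ((Y u + Z u) / √2) 0 p.1)) *
                ENNReal.ofReal (Real.exp (gaussLogRatio b θ ((Y u - Z u) / √2) 0 p.2)))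
              ((x 0 + x 1) / √2, (x 0 - x 1) / √2) := fun x => by
            simp only [hfdef]
            rw [Real.exp_add, ENNReal.ofReal_mul (Real.exp_pos _).le]
          simp_rw [h1]
          rw [lintegral_map (by fun_prop) hXm]
          have := lintegral_map (μ := P)
            (g := fun ω => ((X ω 0 + X ω 1) / √2, (X ω 0 - X ω 1) / √2))
            (f := fun p : ℝ × ℝ =>
                ENNReal.ofReal (Real.exp (gaussLogRatio a θ ((Y u + Z u) / √2) 0 p.1)) *
                ENNReal.ofReal (Real.exp (gaussLogRatio b θ ((Y u - Z u) / √2) 0 p.2)))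
            (by fun_prop) (by fun_prop)
          rw [← this, map_rotatedCoord hXm hX, gaussianPair,
            lintegral_prod_mul
              (f := fun s => ENNReal.ofReal (Real.exp (gaussLogRatio a θ ((Y u + Z u) / √2) 0 s)))
              (g := fun s => ENNReal.ofReal (Real.exp (gaussLogRatio b θ ((Y u - Z u) / √2) 0 s)))
              (by fun_prop) (by fun_prop)]
          exact mul_le_one' (ha _) (hb _)
      _ = 1 := by simp

end Converse

/-! ### Conditional mutual information of a Gaussian variable given the cache -/

section CondLaw

variable {Ω γ : Type*} [MeasurableSpace Ω] [MeasurableSpace γ] {P : Measure Ω}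
  [IsProbabilityMeasure P] {A B : Ω → ℝ} {U : Ω → γ}

/-- Integration against the law that makes `A` and `B` conditionally independent given `U`. -/
theorem lintegral_compProd_condDistrib_prod {F : γ × ℝ × ℝ → ℝ≥0∞} (hF : Measurable F) :
    ∫⁻ q, F q ∂((P.map U).compProd ((condDistrib A U P).prod (condDistrib B U P))) =
      ∫⁻ u, ∫⁻ b, ∫⁻ a, F (u, a, b) ∂(condDistrib A U P u) ∂(condDistrib B U P u) ∂(P.map U) := by
  rw [Measure.lintegral_compProd hF]
  refine lintegral_congr fun u => ?_
  rw [Kernel.prod_apply, lintegral_prod_symm _ (by fun_prop)]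

theorem lintegral_condDistrib (hA : Measurable A) (hU : Measurable U) {F : γ × ℝ → ℝ≥0∞}
    (hF : Measurable F) :
    ∫⁻ u, ∫⁻ a, F (u, a) ∂(condDistrib A U P u) ∂(P.map U) = ∫⁻ ω, F (U ω, A ω) ∂P := by
  rw [← Measure.lintegral_compProd hF, compProd_map_condDistrib hA.aemeasurable,
    lintegral_map hF (by fun_prop)]

/-- The density of a joint law with respect to the product of its marginals integrates to one
over each fibre. -/
theorem ae_lintegral_rnDeriv_prod_eq_one (hA : Measurable A) (hU : Measurable U)
    (hac : P.map (fun ω => (A ω, U ω)) ≪ (P.map A).prod (P.map U)) :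
    ∀ᵐ u ∂(P.map U), ∫⁻ a, (P.map fun ω => (A ω, U ω)).rnDeriv ((P.map A).prod (P.map U)) (a, u)
      ∂(P.map A) = 1 := by
  have hAU : Measurable fun ω => (A ω, U ω) := by fun_prop
  have hr := Measure.measurable_rnDeriv (P.map fun ω => (A ω, U ω)) ((P.map A).prod (P.map U))
  have := Measure.isProbabilityMeasure_map (μ := P) hA.aemeasurable
  have := Measure.isProbabilityMeasure_map (μ := P) hU.aemeasurable
  refine ae_eq_of_forall_setLIntegral_eq_of_sigmaFinite hr.lintegral_prod_left' measurable_const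
    fun s hs _ => ?_
  -- Over `ℝ × s` the density integrates to the joint mass, which is the `U`-marginal mass of `s`;
  -- equality for all `s` identifies the fibre integral almost everywhere.
  have h1 : (P.map fun ω => (A ω, U ω)) (Set.univ ×ˢ s) = (P.map U) s := by
    rw [Measure.map_apply hAU (MeasurableSet.univ.prod hs), Measure.map_apply hU hs]
    congr 1
    ext ω
    simp
  rw [setLIntegral_const, one_mul, ← h1, ← Measure.setLIntegral_rnDeriv hac,
    ← Measure.prod_restrict, lintegral_prod_symm _ hr.aemeasurable, Measure.restrict_univ]

/-- The divergence defining `I(A; B | U)`, for a standard Gaussian `A` estimated by `B`, is at least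
`log (1 / D) / 2 - I(A; U)`. -/
theorem ofReal_le_klDiv_cond (hA : Measurable A) (hB : Measurable B) (hU : Measurable U)
    (hAlaw : P.map A = gaussianReal 0 1)
    (hfin : klDiv (P.map fun ω => (A ω, U ω)) ((P.map A).prod (P.map U)) ≠ ∞)
    {D : ℝ≥0} (hD : D ≠ 0) (hAB : meanSqError P A B ≤ D) :
    ENNReal.ofReal (1 / 2 * Real.log (1 / D) -
        ∫ ω, llr (P.map fun ω => (A ω, U ω)) ((P.map A).prod (P.map U)) (A ω, U ω) ∂P) ≤
      klDiv (P.map fun ω => (U ω, (A ω, B ω)))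
        ((P.map U).compProd ((condDistrib A U P).prod (condDistrib B U P))) := by
  obtain ⟨hac, hint⟩ := klDiv_ne_top_iff.1 hfin
  have hAU : Measurable fun ω => (A ω, U ω) := by fun_prop
  have hUAB : Measurable fun ω => (U ω, (A ω, B ω)) := by fun_prop
  have := Measure.isProbabilityMeasure_map (μ := P) hA.aemeasurable
  have := Measure.isProbabilityMeasure_map (μ := P) hU.aemeasurable
  have := Measure.isProbabilityMeasure_map (μ := P) hAU.aemeasurable
  have := Measure.isProbabilityMeasure_map (μ := P) hUAB.aemeasurable
  set μ := P.map fun ω => (A ω, U ω) with hμ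
  set ν := (P.map A).prod (P.map U) with hν
  have hr : Measurable (μ.rnDeriv ν) := Measure.measurable_rnDeriv μ ν
  have hD' : (0 : ℝ) < D := by positivity
  -- The first term is the gain from estimating `A` by `B` within variance `D`. Subtracting the
  -- information density of `(A, U)` removes what `U` already tells about `A`.
  set f : γ × ℝ × ℝ → ℝ := fun q =>
    gaussLogRatio 1 D q.2.2 0 q.2.1 - llr μ ν (q.2.1, q.1) with hf
  have hl : Measurable fun q : γ × ℝ × ℝ => llr μ ν (q.2.1, q.1) :=
    (measurable_llr μ ν).comp (by fun_prop)
  have hfm : Measurable f := by fun_prop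
  have iAB : Integrable (fun ω => (A ω - B ω) ^ 2) P :=
    integrable_sq_of_lintegral_ne_top (by fun_prop) (hAB.trans_lt ENNReal.coe_lt_top).ne
  have iA : Integrable (fun ω => (A ω - 0) ^ 2) P := by
    simpa using integrable_sq_of_map_eq hA hAlaw
  have iL : Integrable (fun ω => llr μ ν (A ω, U ω)) P :=
    (integrable_map_measure (measurable_llr μ ν).aestronglyMeasurable hAU.aemeasurable).1 hint
  have iG := integrable_gaussLogRatio 1 D iAB iA
  have eAB : ∫ ω, (A ω - B ω) ^ 2 ∂P ≤ D := by
    rw [integral_eq_lintegral_of_nonneg_ae (ae_of_all _ fun _ => sq_nonneg _)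
      iAB.aestronglyMeasurable]
    exact ENNReal.toReal_mono ENNReal.coe_ne_top hAB
  have eA : ∫ ω, (A ω - 0) ^ 2 ∂P = (1 : ℝ) := by
    simpa using integral_sq_of_map_eq hA hAlaw
  have hval : 1 / 2 * Real.log (1 / D) - ∫ ω, llr μ ν (A ω, U ω) ∂P ≤
      ∫ q, f q ∂(P.map fun ω => (U ω, (A ω, B ω))) := by
    rw [integral_map hUAB.aemeasurable hfm.aestronglyMeasurable, hf]
    simp only
    rw [integral_sub iG iL, integral_gaussLogRatio 1 D iAB iA, eA]
    have : (∫ ω, (A ω - B ω) ^ 2 ∂P) / (2 * D) ≤ 1 / 2 := by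
      rw [div_le_div_iff₀ (by positivity) (by norm_num)]
      linarith
    linarith
  have hh : Measurable fun q : γ × ℝ × ℝ =>
      ENNReal.ofReal (Real.exp (gaussLogRatio 1 D q.2.2 0 q.2.1)) *
        (μ.rnDeriv ν (q.2.1, q.1))⁻¹ := Measurable.mul (by fun_prop) (hr.comp (by fun_prop)).inv
  refine (ENNReal.ofReal_le_ofReal hval).trans (ofReal_integral_le_klDiv
    (h := fun q => ENNReal.ofReal (Real.exp (gaussLogRatio 1 D q.2.2 0 q.2.1)) *
      (μ.rnDeriv ν (q.2.1, q.1))⁻¹) ?_ hh ?_ ?_)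
  · exact (integrable_map_measure hfm.aestronglyMeasurable hUAB.aemeasurable).2 (iG.sub iL)
  · have hae : ∀ᵐ ω ∂P, ENNReal.ofReal (Real.exp (llr μ ν (A ω, U ω))) = μ.rnDeriv ν (A ω, U ω) ∧
        0 < μ.rnDeriv ν (A ω, U ω) ∧ μ.rnDeriv ν (A ω, U ω) < ∞ := by
      refine ae_of_ae_map (p := fun q => ENNReal.ofReal (Real.exp (llr μ ν q)) = μ.rnDeriv ν q ∧
        0 < μ.rnDeriv ν q ∧ μ.rnDeriv ν q < ∞) hAU.aemeasurable ?_
      filter_upwards [exp_llr_of_ac μ ν hac, Measure.rnDeriv_pos hac,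
        hac.ae_le (Measure.rnDeriv_lt_top μ ν)] with q h1 h2 h3
      exact ⟨by rw [h1, ENNReal.ofReal_toReal h3.ne], h2, h3⟩
    refine (ae_map_iff hUAB.aemeasurable (measurableSet_le (by fun_prop)
      hh)).2 ?_
    filter_upwards [hae] with ω ⟨h1, h2, h3⟩
    simp only [hf]
    rw [Real.exp_sub, ENNReal.ofReal_div_of_pos (Real.exp_pos _), h1, div_eq_mul_inv]
  · rw [lintegral_compProd_condDistrib_prod hh]
    set κ := condDistrib B U P
    have hg : Measurable fun q : γ × ℝ => ∫⁻ b,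
        ENNReal.ofReal (Real.exp (gaussLogRatio 1 D b 0 q.2)) ∂(κ q.1) := by
      refine Measurable.lintegral_kernel_prod_right' (κ := κ.comap Prod.fst measurable_fst)
        (f := fun q : (γ × ℝ) × ℝ => ENNReal.ofReal (Real.exp (gaussLogRatio 1 D q.2 0 q.1.2))) ?_
      fun_prop
    have hg' : Measurable fun q : γ × ℝ => (μ.rnDeriv ν (q.2, q.1))⁻¹ := (hr.comp (by fun_prop)).inv
    -- Under the conditionally independent law, the factor `(dμ/dν)⁻¹` replaces the law of `A` given
    -- `U` by its marginal. Then `A` is standard normal and independent of `(B, U)`, and the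
    -- Gaussian ratio integrates to one for each value of `B`.
    calc _ = ∫⁻ u, ∫⁻ a, (μ.rnDeriv ν (a, u))⁻¹ *
            ∫⁻ b, ENNReal.ofReal (Real.exp (gaussLogRatio 1 D b 0 a)) ∂(κ u)
            ∂(condDistrib A U P u) ∂(P.map U) := by
          refine lintegral_congr fun u => ?_
          rw [lintegral_lintegral_swap]
          · refine lintegral_congr fun a => ?_
            simp only
            rw [lintegral_mul_const _ (by fun_prop), mul_comm]
          · exact (hh.comp (by fun_prop : Measurable fun q : ℝ × ℝ => (u, q.2, q.1))).aemeasurable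
      _ = ∫⁻ q : ℝ × γ, (μ.rnDeriv ν q)⁻¹ *
            ∫⁻ b, ENNReal.ofReal (Real.exp (gaussLogRatio 1 D b 0 q.1)) ∂(κ q.2) ∂μ := by
          rw [lintegral_condDistrib hA hU (F := fun q => (μ.rnDeriv ν (q.2, q.1))⁻¹ *
            ∫⁻ b, ENNReal.ofReal (Real.exp (gaussLogRatio 1 D b 0 q.2)) ∂(κ q.1)) (hg'.mul hg)]
          exact (lintegral_map (f := fun q : ℝ × γ => (μ.rnDeriv ν q)⁻¹ *
            ∫⁻ b, ENNReal.ofReal (Real.exp (gaussLogRatio 1 D b 0 q.1)) ∂(κ q.2))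
            (hr.inv.mul (hg.comp measurable_swap)) hAU).symm
      _ = ∫⁻ q : ℝ × γ, μ.rnDeriv ν q * ((μ.rnDeriv ν q)⁻¹ *
            ∫⁻ b, ENNReal.ofReal (Real.exp (gaussLogRatio 1 D b 0 q.1)) ∂(κ q.2)) ∂ν :=
          (lintegral_rnDeriv_mul hac (hr.inv.mul (hg.comp measurable_swap)).aemeasurable).symm
      _ ≤ ∫⁻ q : ℝ × γ, ∫⁻ b, ENNReal.ofReal (Real.exp (gaussLogRatio 1 D b 0 q.1)) ∂(κ q.2) ∂ν := by
          refine lintegral_mono fun q => ?_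
          rw [← mul_assoc]
          exact mul_le_of_le_one_left' (ENNReal.mul_inv_le_one _)
      _ = ∫⁻ u, ∫⁻ b, ∫⁻ a, ENNReal.ofReal (Real.exp (gaussLogRatio 1 D b 0 a)) ∂(P.map A)
            ∂(κ u) ∂(P.map U) := by
          rw [hν, lintegral_prod_symm (fun q : ℝ × γ => ∫⁻ b,
            ENNReal.ofReal (Real.exp (gaussLogRatio 1 D b 0 q.1)) ∂(κ q.2))
            (hg.comp measurable_swap).aemeasurable]
          refine lintegral_congr fun u => ?_
          rw [lintegral_lintegral_swap]
          exact Measurable.aemeasurable (by fun_prop)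
      _ = 1 := by
          have := lintegral_exp_gaussLogRatio (v := 1) one_ne_zero hD
          simp only [NNReal.coe_one] at this
          simp [hAlaw, this]
      _ ≤ 1 := le_rfl

end CondLaw

/-! ### Information of the coordinates against information of the pair -/

section SumBound

variable {Ω γ : Type*} [MeasurableSpace Ω] [MeasurableSpace γ] {P : Measure Ω}
  [IsProbabilityMeasure P] {X : Ω → EuclideanSpace ℝ (Fin 2)} {U : Ω → γ} {v w : ℝ≥0}

/-- Data processing under projection to a coordinate; it supplies the finiteness that makes the
coordinate log-likelihood ratios integrable. -/
theorem klDiv_coord_le (hX : Measurable X) (hU : Measurable U) (i : Fin 2) :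
    klDiv (P.map fun ω => (X ω i, U ω)) ((P.map fun ω => X ω i).prod (P.map U)) ≤
      klDiv (P.map fun ω => (X ω, U ω)) ((P.map X).prod (P.map U)) := by
  have := Measure.isProbabilityMeasure_map (μ := P) hX.aemeasurable
  have := Measure.isProbabilityMeasure_map (μ := P) hU.aemeasurable
  have hXU : Measurable fun ω => (X ω, U ω) := by fun_prop
  have := Measure.isProbabilityMeasure_map (μ := P) hXU.aemeasurable
  have hi : Measurable fun x : EuclideanSpace ℝ (Fin 2) => x i := by fun_prop
  have h := klDiv_map_le (μ := P.map fun ω => (X ω, U ω)) (ν := (P.map X).prod (P.map U))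
    (hi.prodMap (measurable_id (α := γ)))
  rwa [← Measure.map_prod_map _ _ hi measurable_id, Measure.map_map hi hX, Measure.map_id,
    Measure.map_map (hi.prodMap measurable_id) hXU] at h

/-- `I(X; U) ≥ I(X₁; U) + I(X₂; U) - I(X₁; X₂)` for a Gaussian pair `X` with unit variances. -/
theorem ofReal_le_klDiv_add (hXm : Measurable X) (hU : Measurable U)
    (hX : P.map X = (gaussianPair v w).map rotation) (hv : v ≠ 0) (hw : w ≠ 0)
    (hX0 : P.map (fun ω => X ω 0) = gaussianReal 0 1)
    (hX1 : P.map (fun ω => X ω 1) = gaussianReal 0 1)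
    (hfin : klDiv (P.map fun ω => (X ω, U ω)) ((P.map X).prod (P.map U)) ≠ ∞) :
    ENNReal.ofReal (∫ ω, llr (P.map fun ω => (X ω 0, U ω))
          ((P.map fun ω => X ω 0).prod (P.map U)) (X ω 0, U ω) ∂P +
        ∫ ω, llr (P.map fun ω => (X ω 1, U ω))
          ((P.map fun ω => X ω 1).prod (P.map U)) (X ω 1, U ω) ∂P + 1 / 2 * Real.log (v * w) +
          1 - (v + w) / 2) ≤
      klDiv (P.map fun ω => (X ω, U ω)) ((P.map X).prod (P.map U)) := by
  obtain ⟨hac0, hint0⟩ := klDiv_ne_top_iff.1 (ne_top_of_le_ne_top hfin (klDiv_coord_le hXm hU 0))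
  obtain ⟨hac1, hint1⟩ := klDiv_ne_top_iff.1 (ne_top_of_le_ne_top hfin (klDiv_coord_le hXm hU 1))
  have hm0 : Measurable fun ω => X ω 0 := by fun_prop
  have hm1 : Measurable fun ω => X ω 1 := by fun_prop
  have hone0 := ae_lintegral_rnDeriv_prod_eq_one hm0 hU hac0
  have hone1 := ae_lintegral_rnDeriv_prod_eq_one hm1 hU hac1
  have hXU : Measurable fun ω => (X ω, U ω) := by fun_prop
  have hXU0 : Measurable fun ω => (X ω 0, U ω) := by fun_prop
  have hXU1 : Measurable fun ω => (X ω 1, U ω) := by fun_prop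
  have := Measure.isProbabilityMeasure_map (μ := P) hXm.aemeasurable
  have := Measure.isProbabilityMeasure_map (μ := P) hU.aemeasurable
  have := Measure.isProbabilityMeasure_map (μ := P) hXU.aemeasurable
  have := Measure.isProbabilityMeasure_map (μ := P) hXU0.aemeasurable
  have := Measure.isProbabilityMeasure_map (μ := P) hXU1.aemeasurable
  rw [hX0] at hac0 hint0 hone0 ⊢
  rw [hX1] at hac1 hint1 hone1 ⊢
  set ν := (gaussianReal 0 1).prod (P.map U) with hν
  set μ0 := P.map fun ω => (X ω 0, U ω) with hμ0
  set μ1 := P.map fun ω => (X ω 1, U ω) with hμ1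
  have hr0 : Measurable (μ0.rnDeriv ν) := Measure.measurable_rnDeriv μ0 ν
  have hr1 : Measurable (μ1.rnDeriv ν) := Measure.measurable_rnDeriv μ1 ν
  -- `exp g` is the density of the standard Gaussian pair with respect to the law of `X`, so `-g` is
  -- the information density of `X₁` and `X₂`.
  set g : EuclideanSpace ℝ (Fin 2) → ℝ := fun x =>
    gaussLogRatio v 1 0 0 ((x 0 + x 1) / √2) + gaussLogRatio w 1 0 0 ((x 0 - x 1) / √2) with hg
  have hgm : Measurable g := by fun_prop
  set f : EuclideanSpace ℝ (Fin 2) × γ → ℝ := fun q =>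
    llr μ0 ν (q.1 0, q.2) + llr μ1 ν (q.1 1, q.2) + g q.1 with hf
  have hl0 : Measurable fun q : EuclideanSpace ℝ (Fin 2) × γ => llr μ0 ν (q.1 0, q.2) :=
    (measurable_llr μ0 ν).comp (by fun_prop)
  have hl1 : Measurable fun q : EuclideanSpace ℝ (Fin 2) × γ => llr μ1 ν (q.1 1, q.2) :=
    (measurable_llr μ1 ν).comp (by fun_prop)
  have hfm : Measurable f := by fun_prop
  have iL0 : Integrable (fun ω => llr μ0 ν (X ω 0, U ω)) P :=
    (integrable_map_measure (measurable_llr μ0 ν).aestronglyMeasurable hXU0.aemeasurable).1 hint0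
  have iL1 : Integrable (fun ω => llr μ1 ν (X ω 1, U ω)) P :=
    (integrable_map_measure (measurable_llr μ1 ν).aestronglyMeasurable hXU1.aemeasurable).1 hint1
  have hs := map_rotatedCoord_fst hXm hX
  have hd := map_rotatedCoord_snd hXm hX
  have is : Integrable (fun ω => ((X ω 0 + X ω 1) / √2 - 0) ^ 2) P := by
    simpa using integrable_sq_of_map_eq (by fun_prop) hs
  have id' : Integrable (fun ω => ((X ω 0 - X ω 1) / √2 - 0) ^ 2) P := by
    simpa using integrable_sq_of_map_eq (by fun_prop) hd
  have es : ∫ ω, ((X ω 0 + X ω 1) / √2 - 0) ^ 2 ∂P = (v : ℝ) := by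
    simpa using integral_sq_of_map_eq (by fun_prop) hs
  have ed : ∫ ω, ((X ω 0 - X ω 1) / √2 - 0) ^ 2 ∂P = (w : ℝ) := by
    simpa using integral_sq_of_map_eq (by fun_prop) hd
  have ig0 := integrable_gaussLogRatio v 1 is is
  have ig1 := integrable_gaussLogRatio w 1 id' id'
  have iG : Integrable (fun ω => g (X ω)) P := ig0.add ig1
  have hv' : (v : ℝ) ≠ 0 := by exact_mod_cast hv
  have hw' : (w : ℝ) ≠ 0 := by exact_mod_cast hw
  have eG : ∫ ω, g (X ω) ∂P = 1 / 2 * Real.log (v * w) + 1 - (v + w) / 2 := by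
    simp only [hg]
    rw [integral_add ig0 ig1, integral_gaussLogRatio v 1 is is, integral_gaussLogRatio w 1 id' id',
      es, ed, Real.log_mul hv' hw', div_one, div_one]
    field_simp
    ring
  have hval : ∫ q, f q ∂(P.map fun ω => (X ω, U ω)) =
      ∫ ω, llr μ0 ν (X ω 0, U ω) ∂P + ∫ ω, llr μ1 ν (X ω 1, U ω) ∂P +
        1 / 2 * Real.log (v * w) + 1 - (v + w) / 2 := by
    rw [integral_map hXU.aemeasurable hfm.aestronglyMeasurable, hf]
    simp only
    have i01 : Integrable (fun ω => llr μ0 ν (X ω 0, U ω) + llr μ1 ν (X ω 1, U ω)) P := iL0.add iL1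
    rw [integral_add i01 iG, integral_add iL0 iL1, eG]
    ring
  rw [← hval]
  have hh : Measurable fun q : EuclideanSpace ℝ (Fin 2) × γ =>
      ENNReal.ofReal (Real.exp (g q.1)) *
        (μ0.rnDeriv ν (q.1 0, q.2) * μ1.rnDeriv ν (q.1 1, q.2)) :=
    Measurable.mul (by fun_prop) ((hr0.comp (by fun_prop)).mul (hr1.comp (by fun_prop)))
  refine ofReal_integral_le_klDiv
    (h := fun q => ENNReal.ofReal (Real.exp (g q.1)) *
      (μ0.rnDeriv ν (q.1 0, q.2) * μ1.rnDeriv ν (q.1 1, q.2))) ?_ hh ?_ ?_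
  · exact (integrable_map_measure hfm.aestronglyMeasurable hXU.aemeasurable).2 ((iL0.add iL1).add iG)
  · refine (ae_map_iff hXU.aemeasurable (measurableSet_le (by fun_prop) hh)).2 ?_
    have hae : ∀ {μ' : Measure (ℝ × γ)} [IsProbabilityMeasure μ'] {V : Ω → ℝ × γ}, Measurable V →
        μ' = P.map V → μ' ≪ ν → ∀ᵐ ω ∂P,
          ENNReal.ofReal (Real.exp (llr μ' ν (V ω))) = μ'.rnDeriv ν (V ω) := by
      intro μ' _ V hV hμ' hac'
      refine ae_of_ae_map (p := fun q => ENNReal.ofReal (Real.exp (llr μ' ν q)) = μ'.rnDeriv ν q)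
        hV.aemeasurable ?_
      rw [← hμ']
      filter_upwards [exp_llr_of_ac μ' ν hac', hac'.ae_le (Measure.rnDeriv_lt_top μ' ν)]
        with q h1 h3
      rw [h1, ENNReal.ofReal_toReal h3.ne]
    filter_upwards [hae hXU0 hμ0 hac0, hae hXU1 hμ1 hac1] with ω h0 h1
    simp only [hf]
    rw [← h0, ← h1, ← ENNReal.ofReal_mul (Real.exp_pos _).le, ← ENNReal.ofReal_mul
      (Real.exp_pos _).le, ← Real.exp_add, ← Real.exp_add, add_comm (g _)]
  · rw [lintegral_prod_symm _ hh.aemeasurable]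
    calc _ = ∫⁻ u, (∫⁻ a, μ0.rnDeriv ν (a, u) ∂(gaussianReal 0 1)) *
            ∫⁻ a, μ1.rnDeriv ν (a, u) ∂(gaussianReal 0 1) ∂(P.map U) := by
          refine lintegral_congr fun u => ?_
          have hru0 : Measurable fun a => μ0.rnDeriv ν (a, u) := hr0.comp (by fun_prop)
          have hru1 : Measurable fun a => μ1.rnDeriv ν (a, u) := hr1.comp (by fun_prop)
          have hF : Measurable fun x : EuclideanSpace ℝ (Fin 2) =>
              μ0.rnDeriv ν (x 0, u) * μ1.rnDeriv ν (x 1, u) :=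
            (hru0.comp (g := fun a => μ0.rnDeriv ν (a, u)) (by fun_prop)).mul
              (hru1.comp (g := fun a => μ1.rnDeriv ν (a, u)) (by fun_prop))
          have hpair : Measurable fun p : ℝ × ℝ => (!₂[p.1, p.2] : EuclideanSpace ℝ (Fin 2)) := by
            refine (WithLp.measurable_toLp 2 _).comp (measurable_pi_iff.2 fun i => ?_)
            fin_cases i <;> simp <;> fun_prop
          have h2 : √2 ^ 2 = (2 : ℝ) := Real.sq_sqrt (by norm_num)
          have h20 : √2 ≠ (0 : ℝ) := by positivity
          have hgr : ∀ p, g (rotation p) =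
              gaussLogRatio v (1 : ℝ≥0) 0 0 p.1 + gaussLogRatio w (1 : ℝ≥0) 0 0 p.2 := fun p => by
            simp only [hg, rotation_apply_zero, rotation_apply_one, NNReal.coe_one]
            congr 2
            · field_simp
              rw [h2]; ring
            · field_simp
              rw [h2]; ring
          rw [hX]
          refine (lintegral_map (((by fun_prop : Measurable fun x => ENNReal.ofReal
            (Real.exp (g x)))).mul hF) measurable_rotation).trans ?_
          simp only [Pi.mul_apply]
          simp_rw [hgr]
          rw [lintegral_gaussianPair_exp_mul hv hw one_ne_zero one_ne_zero 0 0
            (F := fun p => μ0.rnDeriv ν (rotation p 0, u) * μ1.rnDeriv ν (rotation p 1, u))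
            (hF.comp measurable_rotation)]
          -- After `exp g` the pair is isotropic, hence may be read in the original coordinates. The
          -- product of the two densities then splits into two fibre integrals, each equal to one.
          have hlaw := map_rotation_gaussianPair_self 1
          have e1 := lintegral_map (μ := gaussianPair 1 1) hF measurable_rotation
          have e2 := lintegral_map (μ := gaussianPair 1 1) hF hpair
          rw [hlaw, e2] at e1
          rw [gaussianPair] at e1
          rw [← e1]
          exact lintegral_prod_mul (f := fun a => μ0.rnDeriv ν (a, u))
            (g := fun a => μ1.rnDeriv ν (a, u)) hru0.aemeasurable hru1.aemeasurable
      _ = ∫⁻ _, 1 ∂(P.map U) := by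
          refine lintegral_congr_ae ?_
          filter_upwards [hone0, hone1] with u h0 h1
          rw [h0, h1, one_mul]
      _ ≤ 1 := by simp

end SumBound

/-! ### Conversion to bits and marginals of the source -/

theorem log_two_pos : 0 < Real.log 2 := Real.log_pos (by norm_num)

theorem ofReal_mul_log_div (c x : ℝ) :
    ENNReal.ofReal (c * Real.log x) / ENNReal.ofReal (Real.log 2) =
      ENNReal.ofReal (c * Real.logb 2 x) := by
  rw [← ENNReal.ofReal_div_of_pos log_two_pos, mul_div_assoc]
  rfl

theorem map_coord_bivariateGaussian {ρ : ℝ} (hρ : |ρ| ≤ 1) (i : Fin 2) :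
    (bivariateGaussian ρ).map (fun x => x i) = gaussianReal 0 1 := by
  have h := (measurePreserving_eval_multivariateGaussian (μ := 0) (posSemidef_of_abs_le hρ)
    (i := i)).map_eq
  unfold bivariateGaussian
  rw [h]
  fin_cases i <;> simp

theorem map_coord_eq {Ω : Type*} [MeasurableSpace Ω] {P : Measure Ω}
    {X : Ω → EuclideanSpace ℝ (Fin 2)} {ρ : ℝ} (hρ : |ρ| ≤ 1) (hXm : Measurable X)
    (hX : P.map X = bivariateGaussian ρ) (i : Fin 2) :
    P.map (fun ω => X ω i) = gaussianReal 0 1 := by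
  rw [← map_coord_bivariateGaussian hρ i, ← hX, Measure.map_map (by fun_prop) hXm]
  rfl

theorem isProbabilityMeasure_of_map_eq {α β : Type*} [MeasurableSpace α] [MeasurableSpace β]
    {P : Measure α} {f : α → β} (hf : Measurable f) {Q : Measure β} [IsProbabilityMeasure Q]
    (h : P.map f = Q) : IsProbabilityMeasure P := by
  refine ⟨?_⟩
  have := measure_univ (μ := Q)
  rwa [← h, Measure.map_apply hf MeasurableSet.univ, Set.preimage_univ] at this

theorem integral_le_of_meanSqError_le {Ω : Type*} [MeasurableSpace Ω] {P : Measure Ω}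
    {A B : Ω → ℝ} {D : ℝ≥0} (hA : Measurable A) (hB : Measurable B) (h : meanSqError P A B ≤ D) :
    Integrable (fun ω => (A ω - B ω) ^ 2) P ∧ ∫ ω, (A ω - B ω) ^ 2 ∂P ≤ D := by
  have hi : Integrable (fun ω => (A ω - B ω) ^ 2) P :=
    integrable_sq_of_lintegral_ne_top (by fun_prop) (h.trans_lt ENNReal.coe_lt_top).ne
  refine ⟨hi, ?_⟩
  rw [integral_eq_lintegral_of_nonneg_ae (ae_of_all _ fun _ => sq_nonneg _) hi.aestronglyMeasurable]
  exact ENNReal.toReal_mono ENNReal.coe_ne_top h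

/-! ### Conditional means under conditional independence -/

section CondMean

variable {Ω γ : Type*} [MeasurableSpace Ω] [MeasurableSpace γ] {P : Measure Ω}
  [IsProbabilityMeasure P] {A B : Ω → ℝ} {U : Ω → γ}

theorem measurable_condMean : Measurable fun u => ∫ x, x ∂(condDistrib A U P u) :=
  ((stronglyMeasurable_id.comp_measurable measurable_snd).integral_condDistrib
    (f := fun q : γ × ℝ => q.2)).measurable

theorem memLp_condMean (hU : Measurable U) (hA : MemLp A 2 P) :
    MemLp (fun ω => ∫ x, x ∂(condDistrib A U P (U ω))) 2 P :=
  (MemLp.condExp one_le_two hA).ae_eq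
    (condExp_ae_eq_integral_condDistrib' hU (hA.integrable one_le_two))

/-- The tower property: conditioning on `U` replaces `A` by its conditional mean. -/
theorem integral_mul_condMean (hU : Measurable U) (hAm : Measurable A) (hA : MemLp A 2 P) :
    ∫ ω, A ω * ∫ x, x ∂(condDistrib A U P (U ω)) ∂P =
      ∫ ω, (∫ x, x ∂(condDistrib A U P (U ω))) ^ 2 ∂P := by
  have hg := measurable_condMean (A := A) (U := U) (P := P)
  have hUA : Measurable fun ω => (U ω, A ω) := by fun_prop
  have hF : Measurable fun q : γ × ℝ => q.2 * ∫ x, x ∂(condDistrib A U P q.1) :=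
    measurable_snd.mul (hg.comp measurable_fst)
  have hi := (integrable_map_measure hF.aestronglyMeasurable hUA.aemeasurable).2
    (hA.integrable_mul (memLp_condMean hU hA))
  have h1 := integral_map (μ := P) hUA.aemeasurable hF.aestronglyMeasurable
  rw [← compProd_map_condDistrib hAm.aemeasurable] at h1 hi
  rw [Measure.integral_compProd hi] at h1
  refine h1.symm.trans ?_
  simp_rw [integral_mul_const]
  rw [← integral_map (f := fun u => (∫ x, x ∂(condDistrib A U P u)) ^ 2) hU.aemeasurable
    (hg.pow_const 2).aestronglyMeasurable]
  simp_rw [sq]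

theorem integral_mul_eq_of_condIndep (hU : Measurable U) (hAm : Measurable A) (hBm : Measurable B)
    (hA : MemLp A 2 P) (hB : MemLp B 2 P)
    (hlaw : P.map (fun ω => (U ω, A ω, B ω)) =
      (P.map U).compProd ((condDistrib A U P).prod (condDistrib B U P))) :
    ∫ ω, A ω * B ω ∂P = ∫ ω, (∫ x, x ∂(condDistrib A U P (U ω))) *
      ∫ x, x ∂(condDistrib B U P (U ω)) ∂P := by
  have hg := measurable_condMean (A := A) (U := U) (P := P)
  have hg' := measurable_condMean (A := B) (U := U) (P := P)
  have hUA : Measurable fun ω => (U ω, A ω, B ω) := by fun_prop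
  have hF : Measurable fun q : γ × ℝ × ℝ => q.2.1 * q.2.2 := by fun_prop
  have hi := (integrable_map_measure hF.aestronglyMeasurable hUA.aemeasurable).2
    (hA.integrable_mul hB)
  have h1 := integral_map (μ := P) hUA.aemeasurable hF.aestronglyMeasurable
  rw [hlaw] at h1 hi
  rw [Measure.integral_compProd hi] at h1
  refine h1.symm.trans ?_
  rw [← integral_map (f := fun u => (∫ x, x ∂(condDistrib A U P u)) *
    ∫ x, x ∂(condDistrib B U P u)) hU.aemeasurable (hg.mul hg').aestronglyMeasurable]
  refine integral_congr_ae (ae_of_all _ fun u => ?_)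
  simp only [Kernel.prod_apply]
  exact integral_prod_mul (fun x : ℝ => x) (fun x : ℝ => x)

/-- Estimating a Gaussian pair by its conditional means given `U` when the coordinates are
conditionally independent given `U`. -/
theorem condMean_sqError_le (hU : Measurable U) (hAm : Measurable A) (hBm : Measurable B)
    (hA : MemLp A 2 P) (hB : MemLp B 2 P)
    (hlaw : P.map (fun ω => (U ω, A ω, B ω)) =
      (P.map U).compProd ((condDistrib A U P).prod (condDistrib B U P))) :
    Integrable (fun ω => (A ω - ∫ x, x ∂(condDistrib A U P (U ω))) ^ 2) P ∧
    Integrable (fun ω => (B ω - ∫ x, x ∂(condDistrib B U P (U ω))) ^ 2) P ∧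
    ∫ ω, (A ω - ∫ x, x ∂(condDistrib A U P (U ω))) ^ 2 ∂P +
      ∫ ω, (B ω - ∫ x, x ∂(condDistrib B U P (U ω))) ^ 2 ∂P ≤
        ∫ ω, A ω ^ 2 ∂P + ∫ ω, B ω ^ 2 ∂P - 2 * ∫ ω, A ω * B ω ∂P := by
  -- Pythagoras: the conditional mean is an orthogonal projection.
  have key : ∀ {A : Ω → ℝ}, Measurable A → MemLp A 2 P →
      ∫ ω, (A ω - ∫ x, x ∂(condDistrib A U P (U ω))) ^ 2 ∂P =
        ∫ ω, A ω ^ 2 ∂P - ∫ ω, (∫ x, x ∂(condDistrib A U P (U ω))) ^ 2 ∂P := by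
    intro A hAm hA
    have hL := memLp_condMean hU hA
    have e := integral_mul_condMean hU hAm hA
    have i1 := hA.integrable_sq
    have i2 : Integrable (fun ω => 2 * (A ω * ∫ x, x ∂(condDistrib A U P (U ω)))) P :=
      (hA.integrable_mul hL).const_mul 2
    have i12 : Integrable (fun ω => A ω ^ 2 -
      2 * (A ω * ∫ x, x ∂(condDistrib A U P (U ω)))) P := i1.sub i2
    have : ∀ ω, (A ω - ∫ x, x ∂(condDistrib A U P (U ω))) ^ 2 = A ω ^ 2 -
        2 * (A ω * ∫ x, x ∂(condDistrib A U P (U ω))) +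
        (∫ x, x ∂(condDistrib A U P (U ω))) ^ 2 := fun ω => by ring
    simp_rw [this]
    rw [integral_add i12 hL.integrable_sq, integral_sub i1 i2, integral_const_mul, e]
    ring
  have hLA := memLp_condMean hU hA
  have hLB := memLp_condMean hU hB
  refine ⟨(hA.sub hLA).integrable_sq, (hB.sub hLB).integrable_sq, ?_⟩
  rw [key hAm hA, key hBm hB, integral_mul_eq_of_condIndep hU hAm hBm hA hB hlaw]
  -- The total error is `E A² + E B²` minus the second moments of the two conditional means. By the
  -- arithmetic-geometric inequality these moments sum to at least twice the correlation of the
  -- conditional means, which is `E[A B]` by conditional independence.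
  have hn : 0 ≤ ∫ ω, ((∫ x, x ∂(condDistrib A U P (U ω))) -
      ∫ x, x ∂(condDistrib B U P (U ω))) ^ 2 ∂P := integral_nonneg fun _ => sq_nonneg _
  have i2 : Integrable (fun ω => 2 * ((∫ x, x ∂(condDistrib A U P (U ω))) *
      ∫ x, x ∂(condDistrib B U P (U ω)))) P := (hLA.integrable_mul hLB).const_mul 2
  have i12 : Integrable (fun ω => (∫ x, x ∂(condDistrib A U P (U ω))) ^ 2 -
      2 * ((∫ x, x ∂(condDistrib A U P (U ω))) * ∫ x, x ∂(condDistrib B U P (U ω)))) P :=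
    hLA.integrable_sq.sub i2
  simp_rw [sub_sq, mul_assoc] at hn
  rw [integral_add i12 hLB.integrable_sq, integral_sub hLA.integrable_sq i2,
    integral_const_mul] at hn
  linarith

end CondMean

/-- The correlation of a Gaussian pair in rotated coordinates. -/
theorem integral_mul_coord {Ω : Type*} [MeasurableSpace Ω] {P : Measure Ω}
    {X : Ω → EuclideanSpace ℝ (Fin 2)} {v w : ℝ≥0} (hXm : Measurable X)
    (hX : P.map X = (gaussianPair v w).map rotation) :
    ∫ ω, X ω 0 * X ω 1 ∂P = (v - w) / 2 := by
  have hs := map_rotatedCoord_fst hXm hX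
  have hd := map_rotatedCoord_snd hXm hX
  have h : ∀ ω, X ω 0 * X ω 1 =
      (((X ω 0 + X ω 1) / √2) ^ 2 - ((X ω 0 - X ω 1) / √2) ^ 2) / 2 := fun ω => by
    rw [sq_div_sqrt_two, sq_div_sqrt_two]
    ring
  simp_rw [h]
  rw [integral_div, integral_sub (integrable_sq_of_map_eq (by fun_prop) hs)
    (integrable_sq_of_map_eq (by fun_prop) hd), integral_sq_of_map_eq (by fun_prop) hs,
    integral_sq_of_map_eq (by fun_prop) hd]

/-! ### Lower bounds in bits -/

section LowerBounds

variable {ρ : ℝ}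

/-- The mutual information lower bound in bits, when the distortion is at most `1 - ρ`. -/
theorem ofReal_le_mutualInfo {Ω γ : Type*} [MeasurableSpace Ω] [MeasurableSpace γ] {P : Measure Ω}
    [IsProbabilityMeasure P] {X : Ω → EuclideanSpace ℝ (Fin 2)} {U : Ω → γ} (hρ0 : 0 < ρ)
    (hρ1 : ρ < 1) (hXm : Measurable X) (hUm : Measurable U) (hX : P.map X = bivariateGaussian ρ)
    {Y Z : γ → ℝ} (hY : Measurable Y) (hZ : Measurable Z) {D : ℝ≥0} (hD : 0 < D)
    (hYint : Integrable (fun ω => (X ω 0 - Y (U ω)) ^ 2) P)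
    (hZint : Integrable (fun ω => (X ω 1 - Z (U ω)) ^ 2) P)
    (hle : ∫ ω, (X ω 0 - Y (U ω)) ^ 2 ∂P + ∫ ω, (X ω 1 - Z (U ω)) ^ 2 ∂P ≤ 2 * D) :
    ENNReal.ofReal (1 / 2 * Real.logb 2 ((1 - ρ ^ 2) / D ^ 2)) ≤ mutualInfo P X U := by
  have hD' : (0 : ℝ) < D := hD
  obtain ⟨v, hv⟩ : ∃ v : ℝ≥0, (v : ℝ) = 1 + ρ := ⟨⟨1 + ρ, by linarith⟩, rfl⟩
  obtain ⟨w, hw⟩ : ∃ w : ℝ≥0, (w : ℝ) = 1 - ρ := ⟨⟨1 - ρ, by linarith⟩, rfl⟩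
  have hv0 : v ≠ 0 := fun h => by simp [h] at hv; linarith
  have hw0 : w ≠ 0 := fun h => by simp [h] at hw; linarith
  rw [bivariateGaussian_eq_map_rotation hv hw] at hX
  have := ofReal_le_klDiv_of_sqError_le hXm hUm hX hD.ne' (a := v) (b := w)
    (fun m => (lintegral_exp_gaussLogRatio hv0 hD.ne' m 0).le)
    (fun m => (lintegral_exp_gaussLogRatio hw0 hD.ne' m 0).le) hY hZ hYint hZint hle
  rw [← ofReal_mul_log_div, mutualInfo]
  refine ENNReal.div_le_div_right (le_trans (ENNReal.ofReal_le_ofReal (le_of_eq ?_)) this) _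
  rw [hv, hw, ← mul_add, ← Real.log_mul (by positivity) (div_ne_zero (by linarith) hD'.ne')]
  have h1 : (1 + ρ) / D * ((1 - ρ) / D) = (1 - ρ ^ 2) / (D : ℝ) ^ 2 := by
    field_simp
    ring
  have h2 : (1 + ρ) / (2 * (1 + ρ)) = 1 / 2 := by
    have : 1 + ρ ≠ 0 := by linarith
    field_simp
  have h3 : (1 - ρ) / (2 * (1 - ρ)) = 1 / 2 := by
    have : 1 - ρ ≠ 0 := by linarith
    field_simp
  rw [h1, h2, h3, div_self hD'.ne']
  ring

theorem ofReal_le_jointRD (hρ0 : 0 < ρ) (hρ1 : ρ < 1) {D : ℝ≥0} (hD : 0 < D) :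
    ENNReal.ofReal (1 / 2 * Real.logb 2 ((1 - ρ ^ 2) / D ^ 2)) ≤
      jointRD (bivariateGaussian ρ) fun _ => D := by
  refine le_iInf fun P => le_iInf fun hP => le_iInf fun hdist => ?_
  have := isProbabilityMeasure_of_map_eq measurable_fst hP
  obtain ⟨i0, l0⟩ := integral_le_of_meanSqError_le (by fun_prop) (by fun_prop) (hdist 0)
  obtain ⟨i1, l1⟩ := integral_le_of_meanSqError_le (by fun_prop) (by fun_prop) (hdist 1)
  exact ofReal_le_mutualInfo (X := Prod.fst) (U := Prod.snd) hρ0 hρ1 measurable_fst measurable_snd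
    hP (Y := fun y => y 0) (Z := fun y => y 1) (by fun_prop) (by fun_prop) hD i0 i1 (by linarith)

/-- Reverse water-filling past the weak eigenvalue: the difference component is charged its whole
variance `1 - ρ`, and `θ = 2D - (1 - ρ)` is what remains of the error budget for the sum component.
Taking `b = θ ≥ w` makes the weak component contribute no logarithm. -/
theorem ofReal_le_jointRD_of_le (hρ0 : 0 < ρ) (hρ1 : ρ < 1) {D : ℝ≥0} (hD : 1 - ρ ≤ D) :
    ENNReal.ofReal (1 / 2 * Real.logb 2 ((1 + ρ) / (2 * D - (1 - ρ)))) ≤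
      jointRD (bivariateGaussian ρ) fun _ => D := by
  refine le_iInf fun P => le_iInf fun hP => le_iInf fun hdist => ?_
  have := isProbabilityMeasure_of_map_eq measurable_fst hP
  obtain ⟨i0, l0⟩ := integral_le_of_meanSqError_le (by fun_prop) (by fun_prop) (hdist 0)
  obtain ⟨i1, l1⟩ := integral_le_of_meanSqError_le (by fun_prop) (by fun_prop) (hdist 1)
  obtain ⟨v, hv⟩ : ∃ v : ℝ≥0, (v : ℝ) = 1 + ρ := ⟨⟨1 + ρ, by linarith⟩, rfl⟩
  obtain ⟨w, hw⟩ : ∃ w : ℝ≥0, (w : ℝ) = 1 - ρ := ⟨⟨1 - ρ, by linarith⟩, rfl⟩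
  obtain ⟨θ, hθ⟩ : ∃ θ : ℝ≥0, (θ : ℝ) = 2 * D - (1 - ρ) := ⟨⟨2 * D - (1 - ρ), by linarith⟩, rfl⟩
  have hv0 : v ≠ 0 := fun h => by simp [h] at hv; linarith
  have hθ0 : θ ≠ 0 := fun h => by simp [h] at hθ; linarith
  have hwθ : w ≤ θ := by
    rw [← NNReal.coe_le_coe, hw, hθ]
    linarith
  rw [bivariateGaussian_eq_map_rotation hv hw] at hP
  have := ofReal_le_klDiv_of_sqError_le (X := Prod.fst) (U := Prod.snd) measurable_fst
    measurable_snd hP hθ0 (a := v) (b := θ)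
    (fun m => (lintegral_exp_gaussLogRatio hv0 hθ0 m 0).le)
    (fun m => lintegral_exp_gaussLogRatio_self_le hθ0 hwθ m)
    (Y := fun y => y 0) (Z := fun y => y 1) (by fun_prop) (by fun_prop) i0 i1
    (D := D) (by linarith)
  rw [← ofReal_mul_log_div, mutualInfo]
  refine ENNReal.div_le_div_right (le_trans (ENNReal.ofReal_le_ofReal (le_of_eq ?_)) this) _
  have hθ1 : (θ : ℝ) ≠ 0 := by exact_mod_cast hθ0
  have hv1 : (v : ℝ) ≠ 0 := by exact_mod_cast hv0
  rw [← hv, ← hθ, div_self hθ1, Real.log_one]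
  have h2 : (v : ℝ) / (2 * v) = 1 / 2 := by field_simp
  have h3 : (D : ℝ) / θ = 1 / 2 + w / (2 * θ) := by
    field_simp
    linarith
  rw [h2, h3]
  ring

/-- Wyner's common information of a Gaussian pair is at least `log ((1 + ρ) / (1 - ρ)) / 2`. -/
theorem ofReal_le_wynerCI (hρ0 : 0 < ρ) (hρ1 : ρ < 1) :
    ENNReal.ofReal (1 / 2 * Real.logb 2 ((1 + ρ) / (1 - ρ))) ≤ wynerCI (bivariateGaussian ρ) := by
  refine le_iInf fun k => le_iInf fun P => le_iInf fun _ => le_iInf fun hP => le_iInf fun hci => ?_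
  have hX0 : Measurable fun ω : EuclideanSpace ℝ (Fin 2) × (Fin k → ℝ) => ω.1 0 := by fun_prop
  have hX1 : Measurable fun ω : EuclideanSpace ℝ (Fin 2) × (Fin k → ℝ) => ω.1 1 := by fun_prop
  have hU : Measurable fun ω : EuclideanSpace ℝ (Fin 2) × (Fin k → ℝ) => ω.2 := measurable_snd
  have hlaw := (condIndepFun_iff_map_prod_eq_prod_condDistrib_prod_condDistrib hX0 hX1 hU).1 hci
  rw [← Measure.compProd_eq_comp_prod] at hlaw
  have hρ : |ρ| ≤ 1 := abs_le.2 ⟨by linarith, by linarith⟩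
  have g0 := map_coord_eq hρ measurable_fst hP 0
  have g1 := map_coord_eq hρ measurable_fst hP 1
  have A0 : MemLp (fun ω : EuclideanSpace ℝ (Fin 2) × (Fin k → ℝ) => ω.1 0) 2 P :=
    (memLp_two_iff_integrable_sq hX0.aestronglyMeasurable).2 (integrable_sq_of_map_eq hX0 g0)
  have A1 : MemLp (fun ω : EuclideanSpace ℝ (Fin 2) × (Fin k → ℝ) => ω.1 1) 2 P :=
    (memLp_two_iff_integrable_sq hX1.aestronglyMeasurable).2 (integrable_sq_of_map_eq hX1 g1)
  obtain ⟨i0, i1, hle⟩ := condMean_sqError_le hU hX0 hX1 A0 A1 hlaw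
  obtain ⟨v, hv⟩ : ∃ v : ℝ≥0, (v : ℝ) = 1 + ρ := ⟨⟨1 + ρ, by linarith⟩, rfl⟩
  obtain ⟨w, hw⟩ : ∃ w : ℝ≥0, (w : ℝ) = 1 - ρ := ⟨⟨1 - ρ, by linarith⟩, rfl⟩
  have hw0 : 0 < w := by
    rw [← NNReal.coe_pos, hw]
    linarith
  have hcorr := integral_mul_coord measurable_fst
    (hP.trans (bivariateGaussian_eq_map_rotation hv hw))
  have e0 := integral_sq_of_map_eq hX0 g0
  have e1 := integral_sq_of_map_eq hX1 g1
  -- The total error of the conditional means is at most `1 + 1 - 2ρ`, so the distortion bound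
  -- applies with `D = 1 - ρ`.
  rw [hcorr, e0, e1, hv, hw, NNReal.coe_one] at hle
  have h := ofReal_le_mutualInfo (X := Prod.fst) (U := Prod.snd) hρ0 hρ1 measurable_fst
    measurable_snd hP measurable_condMean measurable_condMean hw0 i0 i1 (by rw [hw]; linarith)
  rw [hw] at h
  have h1 : 1 - ρ ≠ 0 := by linarith
  have h2 : (1 - ρ ^ 2) / (1 - ρ) ^ 2 = (1 + ρ) / (1 - ρ) := by
    field_simp
    ring
  rwa [h2] at h

/-- The distortion-cache trade-off is at least the cooperative lower bound. -/
theorem ofReal_le_rdcFunction (hρ0 : 0 < ρ) (hρ1 : ρ < 1) {D C : ℝ≥0} (hD : 0 < D) :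
    ENNReal.ofReal (1 / 4 * Real.logb 2 ((1 - ρ ^ 2) / D ^ 2) - C / 2) ≤
      rdcFunction (bivariateGaussian ρ) (fun _ => D) C := by
  refine le_iInf fun k => le_iInf fun P => le_iInf fun _ => le_iInf fun hP => le_iInf fun hC =>
    le_iInf fun hdist => ?_
  have hρ : |ρ| ≤ 1 := abs_le.2 ⟨by linarith, by linarith⟩
  have hX : Measurable fun ω : EuclideanSpace ℝ (Fin 2) × (Fin k → ℝ) × EuclideanSpace ℝ (Fin 2) =>
    ω.1 := measurable_fst
  have hU : Measurable fun ω : EuclideanSpace ℝ (Fin 2) × (Fin k → ℝ) × EuclideanSpace ℝ (Fin 2) =>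
    ω.2.1 := by fun_prop
  obtain ⟨v, hv⟩ : ∃ v : ℝ≥0, (v : ℝ) = 1 + ρ := ⟨⟨1 + ρ, by linarith⟩, rfl⟩
  obtain ⟨w, hw⟩ : ∃ w : ℝ≥0, (w : ℝ) = 1 - ρ := ⟨⟨1 - ρ, by linarith⟩, rfl⟩
  have hv0 : v ≠ 0 := fun h => by simp [h] at hv; linarith
  have hw0 : w ≠ 0 := fun h => by simp [h] at hw; linarith
  have hL : ENNReal.ofReal (Real.log 2) ≠ 0 := by simpa using log_two_pos
  have hKL : klDiv (P.map fun ω => (ω.1, ω.2.1)) ((P.map fun ω => ω.1).prod (P.map fun ω => ω.2.1))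
      ≤ C * ENNReal.ofReal (Real.log 2) :=
    (ENNReal.div_le_iff hL ENNReal.ofReal_ne_top).1 hC
  have hfin : klDiv (P.map fun ω => (ω.1, ω.2.1))
      ((P.map fun ω => ω.1).prod (P.map fun ω => ω.2.1)) ≠ ∞ :=
    ne_top_of_le_ne_top (ENNReal.mul_ne_top ENNReal.coe_ne_top ENNReal.ofReal_ne_top) hKL
  have g := map_coord_eq hρ hX hP
  have hadd := (ofReal_le_klDiv_add hX hU (hP.trans (bivariateGaussian_eq_map_rotation hv hw))
    hv0 hw0 (g 0) (g 1) hfin).trans hKL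
  have hc := fun l : Fin 2 => ofReal_le_klDiv_cond
    (A := fun ω : EuclideanSpace ℝ (Fin 2) × (Fin k → ℝ) × EuclideanSpace ℝ (Fin 2) => ω.1 l)
    (B := fun ω => ω.2.2 l) (by fun_prop) (by fun_prop) hU (g l)
    (ne_top_of_le_ne_top hfin (klDiv_coord_le hX hU l)) hD.ne' (hdist l)
  rw [← ENNReal.ofReal_coe_nnreal, ← ENNReal.ofReal_mul C.coe_nonneg,
    ENNReal.ofReal_le_ofReal_iff (mul_nonneg C.coe_nonneg log_two_pos.le), hv, hw] at hadd
  have hsup : ∀ l : Fin 2, ENNReal.ofReal ((1 / 2 * Real.log (1 / D) -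
      ∫ ω, llr (P.map fun ω => (ω.1 l, ω.2.1)) ((P.map fun ω => ω.1 l).prod (P.map fun ω => ω.2.1))
        (ω.1 l, ω.2.1) ∂P) / Real.log 2) ≤
      ⨆ l, condMutualInfo P (fun ω => ω.1 l) (fun ω => ω.2.2 l) (fun ω => ω.2.1) := fun l => by
    rw [ENNReal.ofReal_div_of_pos log_two_pos]
    exact (ENNReal.div_le_div_right (hc l) _).trans
      (le_iSup (fun l => condMutualInfo P (fun ω => ω.1 l) (fun ω => ω.2.2 l) (fun ω => ω.2.1)) l)
  refine le_trans ?_ (max_le (hsup 0) (hsup 1))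
  rw [← ENNReal.ofReal_max]
  refine ENNReal.ofReal_le_ofReal ?_
  have hD' : (0 : ℝ) < D := hD
  have hlog : Real.log ((1 - ρ ^ 2) / D ^ 2) = Real.log ((1 + ρ) * (1 - ρ)) + 2 * Real.log (1 / D) := by
    rw [Real.log_div (by nlinarith) (by positivity), Real.log_pow, one_div, Real.log_inv]
    push_cast
    ring_nf
  set a0 := ∫ ω, llr (P.map fun ω => (ω.1 0, ω.2.1))
    ((P.map fun ω => ω.1 0).prod (P.map fun ω => ω.2.1)) (ω.1 0, ω.2.1) ∂P
  set a1 := ∫ ω, llr (P.map fun ω => (ω.1 1, ω.2.1))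
    ((P.map fun ω => ω.1 1).prod (P.map fun ω => ω.2.1)) (ω.1 1, ω.2.1) ∂P
  have hl2 := log_two_pos
  -- The maximum over the two users is at least the average, and `hadd` bounds only the sum `a0 +
  -- a1`.
  have hmax : ∀ x y z : ℝ, 2 * z ≤ x + y → z ≤ max x y := fun x y z h => by
    rcases le_total x y with hxy | hxy
    · exact le_max_of_le_right (by linarith)
    · exact le_max_of_le_left (by linarith)
  apply hmax
  rw [Real.logb, hlog, ← add_div, le_div_iff₀ hl2]
  field_simp
  field_simp at hadd
  linarith

end LowerBounds

/-! ### Information and distortion under a change of probability space -/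

section Transfer

variable {Ω Ω' α β : Type*} [MeasurableSpace Ω] [MeasurableSpace Ω'] [MeasurableSpace α]
  [MeasurableSpace β] {P : Measure Ω} {Φ : Ω → Ω'}

theorem mutualInfo_map (hΦ : Measurable Φ) {A : Ω' → α} {B : Ω' → β} (hA : Measurable A)
    (hB : Measurable B) :
    mutualInfo (P.map Φ) A B = mutualInfo P (fun ω => A (Φ ω)) fun ω => B (Φ ω) := by
  unfold mutualInfo
  rw [Measure.map_map (hA.prodMk hB) hΦ, Measure.map_map hA hΦ, Measure.map_map hB hΦ]
  rfl

theorem meanSqError_map (hΦ : Measurable Φ) {A B : Ω' → ℝ} (hA : Measurable A)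
    (hB : Measurable B) :
    meanSqError (P.map Φ) A B = meanSqError P (fun ω => A (Φ ω)) fun ω => B (Φ ω) := by
  unfold meanSqError
  rw [lintegral_map (by fun_prop) hΦ]

end Transfer

/-! ### Gaussian conditional laws -/

/-- The kernel `u ↦ N(g u, a)`. -/
noncomputable def gaussianKernel {γ : Type*} [MeasurableSpace γ] {g : γ → ℝ} (hg : Measurable g)
    (a : ℝ≥0) : Kernel γ ℝ where
  toFun u := gaussianReal (g u) a
  measurable' := by fun_prop

instance {γ : Type*} [MeasurableSpace γ] {g : γ → ℝ} (hg : Measurable g) (a : ℝ≥0) :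
    IsMarkovKernel (gaussianKernel hg a) :=
  ⟨fun u => inferInstanceAs (IsProbabilityMeasure (gaussianReal (g u) a))⟩

theorem measurable_lintegral_gaussianReal {γ : Type*} [MeasurableSpace γ] {g : γ → ℝ}
    (hg : Measurable g) (a : ℝ≥0) {F : γ → ℝ → ℝ≥0∞} (hF : Measurable (Function.uncurry F)) :
    Measurable fun u => ∫⁻ x, F u x ∂(gaussianReal (g u) a) :=
  Measurable.lintegral_kernel_prod_right' (κ := gaussianKernel hg a) hF

section Cond

variable {Ω γ : Type*} [MeasurableSpace Ω] [MeasurableSpace γ] {P : Measure Ω}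
  [IsProbabilityMeasure P] {A B : Ω → ℝ} {U : Ω → γ} {g : γ → ℝ} {a D : ℝ≥0}

theorem condDistrib_eq_gaussianKernel (hA : Measurable A) (hU : Measurable U) (hg : Measurable g)
    (h : ∀ F : γ × ℝ → ℝ≥0∞, Measurable F → ∫⁻ ω, F (U ω, A ω) ∂P =
      ∫⁻ ω, ∫⁻ x, F (U ω, x) ∂(gaussianReal (g (U ω)) a) ∂P) :
    condDistrib A U P =ᵐ[P.map U] gaussianKernel hg a := by
  refine condDistrib_ae_eq_of_measure_eq_compProd U hA.aemeasurable ?_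
  refine Measure.ext_of_lintegral _ fun F hF => ?_
  rw [lintegral_map hF (by fun_prop), h F hF, Measure.lintegral_compProd hF,
    lintegral_map hF.lintegral_kernel_prod_right' hU]
  rfl

/-- `h1` says that `A` is `N(B, D)` given `(U, B)`, and `h2` that `A` is `N(g U, a)` given `U`. The
density defining the divergence is therefore a ratio of two Gaussian densities, whose quadratic
terms have means that cancel. -/
theorem condMutualInfo_eq (hA : Measurable A) (hB : Measurable B) (hU : Measurable U)
    (hg : Measurable g) (ha : a ≠ 0) (hD : D ≠ 0)
    (hAB : P.map (fun ω => A ω - B ω) = gaussianReal 0 D)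
    (hAU : P.map (fun ω => A ω - g (U ω)) = gaussianReal 0 a)
    (h1 : ∀ F : γ × ℝ × ℝ → ℝ≥0∞, Measurable F → ∫⁻ ω, F (U ω, A ω, B ω) ∂P =
      ∫⁻ ω, ∫⁻ x, F (U ω, x, B ω) ∂(gaussianReal (B ω) D) ∂P)
    (h2 : ∀ F : γ × ℝ → ℝ≥0∞, Measurable F → ∫⁻ ω, F (U ω, A ω) ∂P =
      ∫⁻ ω, ∫⁻ x, F (U ω, x) ∂(gaussianReal (g (U ω)) a) ∂P) :
    condMutualInfo P A B U = ENNReal.ofReal (1 / 2 * Real.logb 2 (a / D)) := by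
  rw [← ofReal_mul_log_div, condMutualInfo]
  congr 1
  have hUAB : Measurable fun ω => (U ω, (A ω, B ω)) := by fun_prop
  have := Measure.isProbabilityMeasure_map (μ := P) hU.aemeasurable
  have := Measure.isProbabilityMeasure_map (μ := P) hUAB.aemeasurable
  set f : γ × ℝ × ℝ → ℝ := fun q => gaussLogRatio a D q.2.2 (g q.1) q.2.1 with hf
  have hfm : Measurable f := by fun_prop
  have i1 : Integrable (fun ω => (A ω - B ω) ^ 2) P := integrable_sq_of_map_eq (by fun_prop) hAB
  have i2 : Integrable (fun ω => (A ω - g (U ω)) ^ 2) P :=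
    integrable_sq_of_map_eq (by fun_prop) hAU
  have e1 : ∫ ω, (A ω - B ω) ^ 2 ∂P = D := integral_sq_of_map_eq (by fun_prop) hAB
  have e2 : ∫ ω, (A ω - g (U ω)) ^ 2 ∂P = a := integral_sq_of_map_eq (by fun_prop) hAU
  rw [klDiv_eq_of_lintegral_eq (f := f) ((integrable_map_measure hfm.aestronglyMeasurable
    hUAB.aemeasurable).2 (integrable_gaussLogRatio a D i1 i2)) hfm]
  · rw [integral_map hUAB.aemeasurable hfm.aestronglyMeasurable, hf]
    simp only
    rw [integral_gaussLogRatio a D i1 i2, e1, e2]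
    have ha' : (a : ℝ) ≠ 0 := by exact_mod_cast ha
    have hD' : (D : ℝ) ≠ 0 := by exact_mod_cast hD
    congr 1
    field_simp
    ring
  · intro F hF
    rw [lintegral_map hF hUAB, h1 F hF, lintegral_compProd_condDistrib_prod (by fun_prop)]
    set κ := condDistrib B U P
    have hG : Measurable fun q : γ × ℝ => ∫⁻ x, F (q.1, x, q.2) ∂(gaussianReal q.2 D) :=
      measurable_lintegral_gaussianReal measurable_snd D
        (F := fun q x => F (q.1, x, q.2)) (by fun_prop)
    calc ∫⁻ ω, ∫⁻ x, F (U ω, x, B ω) ∂(gaussianReal (B ω) D) ∂P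
        = ∫⁻ u, ∫⁻ b, ∫⁻ x, F (u, x, b) ∂(gaussianReal b D) ∂(κ u) ∂(P.map U) :=
          (lintegral_condDistrib hB hU hG).symm
      _ = ∫⁻ u, ∫⁻ b, ∫⁻ x, ENNReal.ofReal (Real.exp (f (u, x, b))) * F (u, x, b)
            ∂(condDistrib A U P u) ∂(κ u) ∂(P.map U) := by
          refine lintegral_congr_ae ?_
          filter_upwards [condDistrib_eq_gaussianKernel hA hU hg h2] with u hu
          refine lintegral_congr fun b => ?_
          rw [hu]
          exact (lintegral_exp_gaussLogRatio_mul ha hD b (g u)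
            (F := fun x => F (u, x, b)) (by fun_prop)).symm

end Cond

/-! ### Additive Gaussian channels on pairs -/

section Pair

theorem map_add_gaussianPair (k l : ℝ≥0) (s : ℝ × ℝ) :
    (gaussianPair k l).map (fun n => s + n) = (gaussianReal s.1 k).prod (gaussianReal s.2 l) := by
  have h : (fun n : ℝ × ℝ => s + n) = Prod.map (fun x => s.1 + x) fun x => s.2 + x := rfl
  rw [h, gaussianPair, ← Measure.map_prod_map _ _ (by fun_prop) (by fun_prop),
    gaussianReal_map_const_add, gaussianReal_map_const_add, zero_add, zero_add]

theorem map_add_prod_gaussianReal (v w : ℝ≥0) :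
    ((gaussianReal 0 v).prod (gaussianReal 0 w)).map (fun p => p.1 + p.2) =
      gaussianReal 0 (v + w) := by
  have := gaussianReal_conv_gaussianReal (m₁ := 0) (m₂ := 0) (v₁ := v) (v₂ := w)
  rw [Measure.conv] at this
  simpa using this

theorem lintegral_gaussianReal_add (v w : ℝ≥0) {F : ℝ → ℝ≥0∞} (hF : Measurable F) :
    ∫⁻ x, ∫⁻ y, F (x + y) ∂(gaussianReal 0 w) ∂(gaussianReal 0 v) =
      ∫⁻ x, F x ∂(gaussianReal 0 (v + w)) := by
  rw [← map_add_prod_gaussianReal, lintegral_map hF (by fun_prop), lintegral_prod _ (by fun_prop)]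

theorem map_add_prod_gaussianPair (v w v' w' : ℝ≥0) :
    ((gaussianPair v w).prod (gaussianPair v' w')).map (fun q => q.1 + q.2) =
      gaussianPair (v + v') (w + w') := by
  refine Measure.ext_of_lintegral _ fun F hF => ?_
  rw [lintegral_map hF (by fun_prop), lintegral_prod _ (by fun_prop), gaussianPair, gaussianPair,
    gaussianPair, lintegral_prod _ (by fun_prop), lintegral_prod _ (by fun_prop),
    ← lintegral_gaussianReal_add v v' (by fun_prop)]
  refine lintegral_congr fun x => ?_
  calc ∫⁻ y, ∫⁻ q, F ((x, y) + q) ∂((gaussianReal 0 v').prod (gaussianReal 0 w'))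
        ∂(gaussianReal 0 w)
      = ∫⁻ y, ∫⁻ x', ∫⁻ y', F (x + x', y + y') ∂(gaussianReal 0 w') ∂(gaussianReal 0 v')
          ∂(gaussianReal 0 w) := by
        refine lintegral_congr fun y => ?_
        rw [lintegral_prod _ (by fun_prop)]
        rfl
    _ = ∫⁻ x', ∫⁻ y, ∫⁻ y', F (x + x', y + y') ∂(gaussianReal 0 w') ∂(gaussianReal 0 w)
          ∂(gaussianReal 0 v') := lintegral_lintegral_swap (by fun_prop)
    _ = _ := by
        refine lintegral_congr fun x' => ?_
        exact lintegral_gaussianReal_add w w' (F := fun y => F (x + x', y)) (by fun_prop)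

theorem rotation_add_apply (p q : ℝ × ℝ) (i : Fin 2) :
    rotation (p + q) i = rotation p i + rotation q i := by
  fin_cases i
  · simp only [Fin.zero_eta, rotation_apply_zero, Prod.fst_add, Prod.snd_add]
    ring
  · simp only [Fin.mk_one, rotation_apply_one, Prod.fst_add, Prod.snd_add]
    ring

theorem map_rotation_apply_gaussianPair {v w a : ℝ≥0} (ha : (v : ℝ) + w = 2 * a) (i : Fin 2) :
    (gaussianPair v w).map (fun p => rotation p i) = gaussianReal 0 a := by
  have key : ∀ c d : ℝ, c ^ 2 = 1 / 2 → d ^ 2 = 1 / 2 →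
      (gaussianPair v w).map (fun p => c * p.1 + d * p.2) = gaussianReal 0 a := by
    intro c d hc hd
    have h : (fun p : ℝ × ℝ => c * p.1 + d * p.2) =
        (fun p : ℝ × ℝ => p.1 + p.2) ∘ Prod.map (fun x => c * x) fun x => d * x := rfl
    rw [h, ← Measure.map_map (by fun_prop) (by fun_prop), gaussianPair,
      ← Measure.map_prod_map _ _ (by fun_prop) (by fun_prop), gaussianReal_map_const_mul,
      gaussianReal_map_const_mul, mul_zero, mul_zero, map_add_prod_gaussianReal]
    congr 1
    ext
    push_cast
    simp only [hc, hd]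
    linarith
  have hs : (1 / √2) ^ 2 = (1 / 2 : ℝ) := by rw [sq_div_sqrt_two]; norm_num
  fin_cases i
  · rw [← key (1 / √2) (1 / √2) hs hs]
    congr 1
    funext p
    simp only [Fin.zero_eta, rotation_apply_zero]
    ring
  · rw [← key (1 / √2) (-(1 / √2)) hs (by rw [neg_sq, hs])]
    congr 1
    funext p
    simp only [Fin.mk_one, rotation_apply_one]
    ring

/-- The divergence defining the mutual information between a Gaussian pair and its noisy version. -/
theorem klDiv_gaussianPair_channel {s t k l v w : ℝ≥0} (hk : k ≠ 0) (hl : l ≠ 0) (hv : s + k = v)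
    (hw : t + l = w) :
    klDiv (((gaussianPair s t).prod (gaussianPair k l)).map fun q => (q.1 + q.2, q.1))
        ((gaussianPair v w).prod (gaussianPair s t)) =
      ENNReal.ofReal (1 / 2 * Real.log (v * w / (k * l))) := by
  have hv0 : v ≠ 0 := fun h => hk (by rw [h] at hv; exact (add_eq_zero.1 hv).2)
  have hw0 : w ≠ 0 := fun h => hl (by rw [h] at hw; exact (add_eq_zero.1 hw).2)
  set Q := (gaussianPair s t).prod (gaussianPair k l) with hQ
  have hm : Measurable fun q : (ℝ × ℝ) × ℝ × ℝ => (q.1 + q.2, q.1) := by fun_prop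
  have := Measure.isProbabilityMeasure_map (μ := Q) hm.aemeasurable
  -- Given the input `p`, the output has independent coordinates `N(p.1, k)` and `N(p.2, l)`; `f`
  -- compares this with the output marginal. Only the noise must be nondegenerate: an input variance
  -- may vanish.
  set f : (ℝ × ℝ) × ℝ × ℝ → ℝ := fun q =>
    gaussLogRatio v k q.2.1 0 q.1.1 + gaussLogRatio w l q.2.2 0 q.1.2 with hf
  have hfm : Measurable f := by fun_prop
  have hsum : Q.map (fun q => q.1 + q.2) = gaussianPair v w := by
    rw [hQ, map_add_prod_gaussianPair, hv, hw]
  have hN : Q.map Prod.snd = gaussianPair k l := by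
    rw [hQ, Measure.map_snd_prod]
    simp
  have m1 : Q.map (fun q => q.1.1 + q.2.1) = gaussianReal 0 v := by
    have := congrArg (Measure.map Prod.fst) hsum
    rw [Measure.map_map (by fun_prop) (by fun_prop), gaussianPair, Measure.map_fst_prod] at this
    simpa [Function.comp_def] using this
  have m2 : Q.map (fun q => q.1.2 + q.2.2) = gaussianReal 0 w := by
    have := congrArg (Measure.map Prod.snd) hsum
    rw [Measure.map_map (by fun_prop) (by fun_prop), gaussianPair, Measure.map_snd_prod] at this
    simpa [Function.comp_def] using this
  have n1 : Q.map (fun q => q.2.1) = gaussianReal 0 k := by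
    have := congrArg (Measure.map Prod.fst) hN
    rw [Measure.map_map (by fun_prop) (by fun_prop), gaussianPair, Measure.map_fst_prod] at this
    simpa [Function.comp_def] using this
  have n2 : Q.map (fun q => q.2.2) = gaussianReal 0 l := by
    have := congrArg (Measure.map Prod.snd) hN
    rw [Measure.map_map (by fun_prop) (by fun_prop), gaussianPair, Measure.map_snd_prod] at this
    simpa [Function.comp_def] using this
  have i1 : Integrable (fun q : (ℝ × ℝ) × ℝ × ℝ => (q.1.1 + q.2.1 - q.1.1) ^ 2) Q := by
    simpa using integrable_sq_of_map_eq (by fun_prop) n1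
  have i2 : Integrable (fun q : (ℝ × ℝ) × ℝ × ℝ => (q.1.1 + q.2.1 - 0) ^ 2) Q := by
    simpa using integrable_sq_of_map_eq (by fun_prop) m1
  have j1 : Integrable (fun q : (ℝ × ℝ) × ℝ × ℝ => (q.1.2 + q.2.2 - q.1.2) ^ 2) Q := by
    simpa using integrable_sq_of_map_eq (by fun_prop) n2
  have j2 : Integrable (fun q : (ℝ × ℝ) × ℝ × ℝ => (q.1.2 + q.2.2 - 0) ^ 2) Q := by
    simpa using integrable_sq_of_map_eq (by fun_prop) m2
  have e1 : ∫ q, (q.1.1 + q.2.1 - q.1.1) ^ 2 ∂Q = (k : ℝ) := by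
    simpa using integral_sq_of_map_eq (by fun_prop) n1
  have e2 : ∫ q, (q.1.1 + q.2.1 - 0) ^ 2 ∂Q = (v : ℝ) := by
    simpa using integral_sq_of_map_eq (by fun_prop) m1
  have e3 : ∫ q, (q.1.2 + q.2.2 - q.1.2) ^ 2 ∂Q = (l : ℝ) := by
    simpa using integral_sq_of_map_eq (by fun_prop) n2
  have e4 : ∫ q, (q.1.2 + q.2.2 - 0) ^ 2 ∂Q = (w : ℝ) := by
    simpa using integral_sq_of_map_eq (by fun_prop) m2
  have g1 := integrable_gaussLogRatio v k i1 i2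
  have g2 := integrable_gaussLogRatio w l j1 j2
  rw [klDiv_eq_of_lintegral_eq (f := f) ((integrable_map_measure hfm.aestronglyMeasurable
    hm.aemeasurable).2 (g1.add g2)) hfm]
  · rw [integral_map hm.aemeasurable hfm.aestronglyMeasurable, hf]
    simp only [Prod.fst_add, Prod.snd_add]
    rw [integral_add g1 g2, integral_gaussLogRatio v k i1 i2, integral_gaussLogRatio w l j1 j2,
      e1, e2, e3, e4]
    have hk' : (k : ℝ) ≠ 0 := by exact_mod_cast hk
    have hl' : (l : ℝ) ≠ 0 := by exact_mod_cast hl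
    have hv' : (v : ℝ) ≠ 0 := by exact_mod_cast hv0
    have hw' : (w : ℝ) ≠ 0 := by exact_mod_cast hw0
    rw [mul_div_mul_comm, Real.log_mul (div_ne_zero hv' hk') (div_ne_zero hw' hl')]
    congr 1
    field_simp
    ring
  · intro F hF
    rw [lintegral_map hF hm, hQ, lintegral_prod _ (by fun_prop),
      lintegral_prod_symm _ (by fun_prop)]
    refine lintegral_congr fun p => ?_
    rw [lintegral_gaussianPair_exp_mul hv0 hw0 hk hl p.1 p.2 (F := fun x => F (x, p))
      (by fun_prop), ← map_add_gaussianPair, lintegral_map (by fun_prop) (by fun_prop)]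

/-- Data processing along `rotation × g` yields the inequality, which suffices for achievability, so
`g` need not be injective. -/
theorem mutualInfo_gaussianPair_channel_le {β : Type*} [MeasurableSpace β] {s t k l v w : ℝ≥0}
    (hk : k ≠ 0) (hl : l ≠ 0) (hv : s + k = v) (hw : t + l = w) {g : ℝ × ℝ → β}
    (hg : Measurable g) :
    mutualInfo ((gaussianPair s t).prod (gaussianPair k l)) (fun q => rotation (q.1 + q.2))
      (fun q => g q.1) ≤ ENNReal.ofReal (1 / 2 * Real.logb 2 (v * w / (k * l))) := by
  rw [← ofReal_mul_log_div, mutualInfo, ← klDiv_gaussianPair_channel hk hl hv hw]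
  refine ENNReal.div_le_div_right ?_ _
  set Q := (gaussianPair s t).prod (gaussianPair k l) with hQ
  have hm : Measurable fun q : (ℝ × ℝ) × ℝ × ℝ => (q.1 + q.2, q.1) := by fun_prop
  have := Measure.isProbabilityMeasure_map (μ := Q) hm.aemeasurable
  have h := klDiv_map_le (μ := Q.map fun q => (q.1 + q.2, q.1))
    (ν := (gaussianPair v w).prod (gaussianPair s t)) (measurable_rotation.prodMap hg)
  rw [← Measure.map_prod_map _ _ measurable_rotation hg,
    Measure.map_map (measurable_rotation.prodMap hg) hm] at h
  have h1 : (gaussianPair v w).map rotation = Q.map fun q => rotation (q.1 + q.2) := by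
    rw [← hv, ← hw, ← map_add_prod_gaussianPair, Measure.map_map measurable_rotation (by fun_prop)]
    rfl
  have h2 : (gaussianPair s t).map g = Q.map fun q => g q.1 := by
    have : (fun q : (ℝ × ℝ) × ℝ × ℝ => g q.1) = g ∘ Prod.fst := rfl
    rw [this, ← Measure.map_map hg measurable_fst, hQ, Measure.map_fst_prod]
    simp
  rw [h1, h2] at h
  exact h

theorem meanSqError_eq {Ω : Type*} [MeasurableSpace Ω] {P : Measure Ω} {A B : Ω → ℝ} {D : ℝ≥0}
    (hA : Measurable A) (hB : Measurable B) (h : P.map (fun ω => A ω - B ω) = gaussianReal 0 D) :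
    meanSqError P A B = D := by
  have hi := integrable_sq_of_map_eq (by fun_prop) h
  rw [meanSqError, ← ofReal_integral_eq_lintegral_ofReal hi (ae_of_all _ fun _ => sq_nonneg _),
    integral_sq_of_map_eq (by fun_prop) h, ENNReal.ofReal_coe_nnreal]

end Pair

theorem map_rotation_add_eq {s t k l v w : ℝ≥0} (hv : s + k = v) (hw : t + l = w) :
    ((gaussianPair s t).prod (gaussianPair k l)).map (fun q => rotation (q.1 + q.2)) =
      (gaussianPair v w).map rotation := by
  rw [← hv, ← hw, ← map_add_prod_gaussianPair, Measure.map_map measurable_rotation (by fun_prop)]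
  rfl

theorem map_snd_rotation_apply {s t k l a : ℝ≥0} (ha : (k : ℝ) + l = 2 * a) (i : Fin 2) :
    ((gaussianPair s t).prod (gaussianPair k l)).map (fun q => rotation q.2 i) =
      gaussianReal 0 a := by
  rw [← map_rotation_apply_gaussianPair ha i]
  have : (fun q : (ℝ × ℝ) × ℝ × ℝ => rotation q.2 i) = (fun p => rotation p i) ∘ Prod.snd := rfl
  rw [this, ← Measure.map_map (by fun_prop) measurable_snd, Measure.map_snd_prod]
  simp

/-! ### Test channels for the joint rate-distortion function and the common information -/

section Achievability

variable {ρ : ℝ}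

/-- The Gaussian test channel with noise variances `k`, `l` in rotated coordinates. -/
theorem jointRD_le {k l : ℝ} (hk : 0 < k) (hl : 0 < l) (hkρ : k ≤ 1 + ρ) (hlρ : l ≤ 1 - ρ)
    {D : ℝ≥0} (hD : k + l ≤ 2 * D) :
    jointRD (bivariateGaussian ρ) (fun _ => D) ≤
      ENNReal.ofReal (1 / 2 * Real.logb 2 ((1 - ρ ^ 2) / (k * l))) := by
  obtain ⟨s, hs⟩ : ∃ s : ℝ≥0, (s : ℝ) = 1 + ρ - k := ⟨⟨1 + ρ - k, by linarith⟩, rfl⟩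
  obtain ⟨t, ht⟩ : ∃ t : ℝ≥0, (t : ℝ) = 1 - ρ - l := ⟨⟨1 - ρ - l, by linarith⟩, rfl⟩
  lift k to ℝ≥0 using hk.le
  lift l to ℝ≥0 using hl.le
  have hv : (s : ℝ) + k = 1 + ρ := by linarith
  have hw : (t : ℝ) + l = 1 - ρ := by linarith
  have hΦ : Measurable fun q : (ℝ × ℝ) × ℝ × ℝ => (rotation (q.1 + q.2), rotation q.1) := by fun_prop
  refine iInf_le_of_le (((gaussianPair s t).prod (gaussianPair k l)).map
    fun q => (rotation (q.1 + q.2), rotation q.1)) (iInf₂_le_of_le ?_ ?_ ?_)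
  · rw [Measure.map_map measurable_fst hΦ, bivariateGaussian_eq_map_rotation (v := s + k)
      (w := t + l) (by push_cast; exact hv) (by push_cast; exact hw), ← map_rotation_add_eq rfl rfl]
    rfl
  · intro i
    rw [meanSqError_map hΦ (by fun_prop) (by fun_prop), meanSqError_eq (D := (k + l) / 2)
      (by fun_prop) (by fun_prop)]
    · rw [ENNReal.coe_le_coe, ← NNReal.coe_le_coe]
      push_cast
      linarith
    · simp only [rotation_add_apply, add_sub_cancel_left]
      exact map_snd_rotation_apply (by push_cast; ring) i
  · rw [mutualInfo_map hΦ (by fun_prop) (by fun_prop)]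
    refine (mutualInfo_gaussianPair_channel_le (by simpa using hk.ne') (by simpa using hl.ne') rfl
      rfl measurable_rotation).trans_eq ?_
    push_cast
    rw [hv, hw]
    ring_nf

/-- The rotated vector as a tuple. -/
noncomputable def rotationTuple (p : ℝ × ℝ) : Fin 2 → ℝ := fun i => rotation p i

@[fun_prop]
theorem measurable_rotationTuple : Measurable rotationTuple := by
  unfold rotationTuple
  fun_prop

theorem lintegral_gaussianPair_self_rotation (k : ℝ≥0) (a b : ℝ) {F : ℝ → ℝ → ℝ≥0∞}
    (hF : Measurable (Function.uncurry F)) :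
    ∫⁻ p, F (a + rotation p 0) (b + rotation p 1) ∂(gaussianPair k k) =
      ∫⁻ x, ∫⁻ y, F x y ∂(gaussianReal b k) ∂(gaussianReal a k) := by
  have hpair : Measurable fun p : ℝ × ℝ => (!₂[p.1, p.2] : EuclideanSpace ℝ (Fin 2)) := by
    refine (WithLp.measurable_toLp 2 _).comp (measurable_pi_iff.2 fun i => ?_)
    fin_cases i <;> simp <;> fun_prop
  have hG : Measurable fun x : EuclideanSpace ℝ (Fin 2) => F (a + x 0) (b + x 1) :=
    hF.comp (g := Function.uncurry F) (by fun_prop : Measurable fun x : EuclideanSpace ℝ (Fin 2) =>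
      (a + x 0, b + x 1))
  have e1 := lintegral_map (μ := gaussianPair k k) hG measurable_rotation
  rw [map_rotation_gaussianPair_self, lintegral_map hG hpair] at e1
  rw [← e1]
  have e2 := lintegral_map (μ := gaussianPair k k) hF
    (by fun_prop : Measurable fun n : ℝ × ℝ => (a, b) + n)
  rw [map_add_gaussianPair, lintegral_prod _ (by fun_prop)] at e2
  exact e2.symm

/-- Let `U` carry only a sum component, of variance `2ρ`. The remaining noise is isotropic of
variance `1 - ρ`, hence independent across the original coordinates, so `X₁` and `X₂` are
conditionally independent given `U`. -/
theorem wynerCI_le (hρ0 : 0 < ρ) (hρ1 : ρ < 1) :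
    wynerCI (bivariateGaussian ρ) ≤ ENNReal.ofReal (1 / 2 * Real.logb 2 ((1 + ρ) / (1 - ρ))) := by
  obtain ⟨s, hs⟩ : ∃ s : ℝ≥0, (s : ℝ) = 2 * ρ := ⟨⟨2 * ρ, by linarith⟩, rfl⟩
  obtain ⟨k, hk⟩ : ∃ k : ℝ≥0, (k : ℝ) = 1 - ρ := ⟨⟨1 - ρ, by linarith⟩, rfl⟩
  have hk0 : k ≠ 0 := fun h => by simp [h] at hk; linarith
  have hv : (s : ℝ) + k = 1 + ρ := by rw [hs, hk]; ring
  have hw : ((0 : ℝ≥0) : ℝ) + k = 1 - ρ := by rw [hk]; simp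
  have hΦ : Measurable fun q : (ℝ × ℝ) × ℝ × ℝ => (rotation (q.1 + q.2), rotationTuple q.1) := by
    fun_prop
  set Q := (gaussianPair s 0).prod (gaussianPair k k) with hQ
  have hP := Measure.isProbabilityMeasure_map (μ := Q) hΦ.aemeasurable
  set P := Q.map fun q => (rotation (q.1 + q.2), rotationTuple q.1) with hPdef
  refine iInf_le_of_le 2 (iInf_le_of_le P (iInf_le_of_le hP (iInf₂_le_of_le ?_ ?_ ?_)))
  · rw [Measure.map_map measurable_fst hΦ, bivariateGaussian_eq_map_rotation (v := s + k)
      (w := 0 + k) (by push_cast; exact hv) (by push_cast; exact hw), ← map_rotation_add_eq rfl rfl]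
    rfl
  · have hX0 : Measurable fun ω : EuclideanSpace ℝ (Fin 2) × (Fin 2 → ℝ) => ω.1 0 := by fun_prop
    have hX1 : Measurable fun ω : EuclideanSpace ℝ (Fin 2) × (Fin 2 → ℝ) => ω.1 1 := by fun_prop
    have hU : Measurable fun ω : EuclideanSpace ℝ (Fin 2) × (Fin 2 → ℝ) => ω.2 := measurable_snd
    refine (condIndepFun_iff_map_prod_eq_prod_condDistrib_prod_condDistrib hX0 hX1 hU).2 ?_
    rw [← Measure.compProd_eq_comp_prod]
    -- Given `U`, the coordinates are independent Gaussians centred at the entries of `U`. Both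
    -- single conditional laws and the joint one are read off from this identity.
    have hgen : ∀ F : (Fin 2 → ℝ) → ℝ → ℝ → ℝ≥0∞,
        (Measurable fun x : (Fin 2 → ℝ) × ℝ × ℝ => F x.1 x.2.1 x.2.2) →
        ∫⁻ ω, F ω.2 (ω.1 0) (ω.1 1) ∂P =
        ∫⁻ ω, ∫⁻ x, ∫⁻ y, F ω.2 x y ∂(gaussianReal (ω.2 1) k) ∂(gaussianReal (ω.2 0) k) ∂P := by
      intro F hF
      have hF1 : Measurable fun ω : EuclideanSpace ℝ (Fin 2) × (Fin 2 → ℝ) =>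
          F ω.2 (ω.1 0) (ω.1 1) := hF.comp (by fun_prop :
            Measurable fun ω : EuclideanSpace ℝ (Fin 2) × (Fin 2 → ℝ) => (ω.2, ω.1 0, ω.1 1))
      have hF2 : Measurable fun ω : EuclideanSpace ℝ (Fin 2) × (Fin 2 → ℝ) =>
          ∫⁻ x, ∫⁻ y, F ω.2 x y ∂(gaussianReal (ω.2 1) k) ∂(gaussianReal (ω.2 0) k) := by
        refine measurable_lintegral_gaussianReal (by fun_prop) k
          (measurable_lintegral_gaussianReal (by fun_prop) k ?_)
        exact hF.comp (by fun_prop : Measurable fun r : ((EuclideanSpace ℝ (Fin 2) ×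
          (Fin 2 → ℝ)) × ℝ) × ℝ => (r.1.1.2, r.1.2, r.2))
      rw [hPdef, lintegral_map hF1 hΦ, lintegral_map hF2 hΦ, hQ]
      refine (lintegral_prod _ (hF1.comp hΦ).aemeasurable).trans
        (Eq.trans ?_ (lintegral_prod _ (hF2.comp hΦ).aemeasurable).symm)
      refine lintegral_congr fun p => ?_
      simp only [Function.comp, rotation_add_apply, lintegral_const, measure_univ, mul_one]
      exact lintegral_gaussianPair_self_rotation k (rotation p 0) (rotation p 1)
        (F := F (rotationTuple p)) (hF.comp (by fun_prop :
          Measurable fun r : ℝ × ℝ => (rotationTuple p, r.1, r.2)))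
    have c0 := condDistrib_eq_gaussianKernel (P := P) (a := k) hX0 hU
      (measurable_pi_apply 0) (fun F hF => by
        have := hgen (fun u x _ => F (u, x)) (by fun_prop)
        simpa using this)
    have c1 := condDistrib_eq_gaussianKernel (P := P) (a := k) hX1 hU
      (measurable_pi_apply 1) (fun F hF => by
        have := hgen (fun u _ x => F (u, x)) (by fun_prop)
        simpa using this)
    refine Measure.ext_of_lintegral _ fun F hF => ?_
    rw [lintegral_map hF (by fun_prop), hgen (fun u x y => F (u, x, y)) hF,
      Measure.lintegral_compProd hF]
    have hm : Measurable fun u : Fin 2 → ℝ =>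
        ∫⁻ x, ∫⁻ y, F (u, x, y) ∂(gaussianReal (u 1) k) ∂(gaussianReal (u 0) k) := by
      refine measurable_lintegral_gaussianReal (by fun_prop) k
        (measurable_lintegral_gaussianReal (by fun_prop) k ?_)
      exact hF.comp (by fun_prop : Measurable fun r : ((Fin 2 → ℝ) × ℝ) × ℝ =>
        (r.1.1, r.1.2, r.2))
    refine (lintegral_map hm hU).symm.trans (lintegral_congr_ae ?_)
    filter_upwards [c0, c1] with u h0 h1
    rw [Kernel.prod_apply, lintegral_prod _ (by fun_prop), h0, h1]
    rfl
  · rw [hPdef, mutualInfo_map hΦ (by fun_prop) (by fun_prop)]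
    refine (mutualInfo_gaussianPair_channel_le hk0 hk0 rfl rfl measurable_rotationTuple).trans_eq ?_
    rw [NNReal.coe_add, NNReal.coe_add, hv, hw, hk]
    have : 1 - ρ ≠ 0 := by linarith
    congr 3
    field_simp

end Achievability

theorem lintegral_gaussianPair_rotation_apply {v w a : ℝ≥0} (ha : (v : ℝ) + w = 2 * a) (i : Fin 2)
    (b : ℝ) {F : ℝ → ℝ≥0∞} (hF : Measurable F) :
    ∫⁻ p, F (b + rotation p i) ∂(gaussianPair v w) = ∫⁻ x, F x ∂(gaussianReal b a) := by
  have h := gaussianReal_map_const_add (μ := 0) (v := a) b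
  rw [zero_add, ← map_rotation_apply_gaussianPair ha i,
    Measure.map_map (by fun_prop) (by fun_prop)] at h
  rw [← h, lintegral_map hF (by fun_prop)]
  rfl

/-! ### The cache-and-refine channel -/

section Channel

variable {s t m n z y : ℝ≥0}

/-- The joint law of `(X, U, X̂)` where `U` is a Gaussian description of `X`, `X̂` a refinement of
`U`, and all covariance matrices are diagonal in rotated coordinates. -/
noncomputable def cacheChannel (s t m n z y : ℝ≥0) :
    Measure (EuclideanSpace ℝ (Fin 2) × (Fin 2 → ℝ) × EuclideanSpace ℝ (Fin 2)) :=
  ((gaussianPair s t).prod ((gaussianPair m n).prod (gaussianPair z y))).map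
    fun q => (rotation (q.1 + (q.2.1 + q.2.2)), rotationTuple q.1, rotation (q.1 + q.2.1))

theorem measurable_cacheChannel : Measurable fun q : (ℝ × ℝ) × (ℝ × ℝ) × ℝ × ℝ =>
    (rotation (q.1 + (q.2.1 + q.2.2)), rotationTuple q.1, rotation (q.1 + q.2.1)) := by
  fun_prop

instance : IsProbabilityMeasure (cacheChannel s t m n z y) :=
  Measure.isProbabilityMeasure_map measurable_cacheChannel.aemeasurable

theorem map_merge_noise :
    ((gaussianPair s t).prod ((gaussianPair m n).prod (gaussianPair z y))).map
      (fun q => (q.1, q.2.1 + q.2.2)) =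
    (gaussianPair s t).prod (gaussianPair (m + z) (n + y)) := by
  have h : (fun q : (ℝ × ℝ) × (ℝ × ℝ) × ℝ × ℝ => (q.1, q.2.1 + q.2.2)) =
      Prod.map id fun r : (ℝ × ℝ) × ℝ × ℝ => r.1 + r.2 := rfl
  rw [h, ← Measure.map_prod_map _ _ measurable_id (by fun_prop), Measure.map_id,
    map_add_prod_gaussianPair]

theorem map_fst_cacheChannel :
    (cacheChannel s t m n z y).map (fun ω => ω.1) =
      (gaussianPair (s + (m + z)) (t + (n + y))).map rotation := by
  rw [cacheChannel, Measure.map_map measurable_fst measurable_cacheChannel,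
    ← map_rotation_add_eq rfl rfl, ← map_merge_noise, Measure.map_map (by fun_prop) (by fun_prop)]
  rfl

theorem mutualInfo_cacheChannel_le (hk : m + z ≠ 0) (hl : n + y ≠ 0) :
    mutualInfo (cacheChannel s t m n z y) (fun ω => ω.1) (fun ω => ω.2.1) ≤
      ENNReal.ofReal (1 / 2 * Real.logb 2 (((s + (m + z) : ℝ≥0) : ℝ) * (t + (n + y) : ℝ≥0) /
        ((m + z : ℝ≥0) * (n + y : ℝ≥0)))) := by
  refine le_trans (le_of_eq ?_)
    (mutualInfo_gaussianPair_channel_le hk hl rfl rfl measurable_rotationTuple)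
  rw [← map_merge_noise, mutualInfo_map (by fun_prop) (by fun_prop) (by fun_prop), cacheChannel,
    mutualInfo_map measurable_cacheChannel (by fun_prop) (by fun_prop)]

theorem map_error_cacheChannel {E : ℝ≥0} (hE : (z : ℝ) + y = 2 * E) (i : Fin 2) :
    (cacheChannel s t m n z y).map (fun ω => ω.1 i - ω.2.2 i) = gaussianReal 0 E := by
  rw [cacheChannel, Measure.map_map (by fun_prop) measurable_cacheChannel]
  have h : ((fun ω : EuclideanSpace ℝ (Fin 2) × (Fin 2 → ℝ) × EuclideanSpace ℝ (Fin 2) =>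
      ω.1 i - ω.2.2 i) ∘ fun q : (ℝ × ℝ) × (ℝ × ℝ) × ℝ × ℝ =>
      (rotation (q.1 + (q.2.1 + q.2.2)), rotationTuple q.1, rotation (q.1 + q.2.1))) =
      (fun r : (ℝ × ℝ) × ℝ × ℝ => rotation r.2 i) ∘ Prod.snd := by
    funext q
    simp only [Function.comp, rotation_add_apply]
    ring
  rw [h, ← Measure.map_map (by fun_prop) measurable_snd, Measure.map_snd_prod]
  simpa using map_snd_rotation_apply hE i

theorem map_cacheError_cacheChannel {a : ℝ≥0} (ha : ((m + z : ℝ≥0) : ℝ) + (n + y : ℝ≥0) = 2 * a)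
    (i : Fin 2) :
    (cacheChannel s t m n z y).map (fun ω => ω.1 i - ω.2.1 i) = gaussianReal 0 a := by
  rw [← map_snd_rotation_apply (s := s) (t := t) ha i, ← map_merge_noise, cacheChannel,
    Measure.map_map (by fun_prop) measurable_cacheChannel,
    Measure.map_map (by fun_prop) (by fun_prop)]
  congr 1
  funext q
  simp only [Function.comp, rotation_add_apply, rotationTuple]
  ring

/-- Each user sees only one original coordinate, in which noise of rotated variances `z`, `y` has
variance `(z + y) / 2`. Thus only the averages `a` and `E` enter, even when the rotated variances
differ. -/
theorem condMutualInfo_cacheChannel {a E : ℝ≥0} (ha : ((m + z : ℝ≥0) : ℝ) + (n + y : ℝ≥0) = 2 * a)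
    (hE : (z : ℝ) + y = 2 * E) (ha0 : a ≠ 0) (hE0 : E ≠ 0) (i : Fin 2) :
    condMutualInfo (cacheChannel s t m n z y) (fun ω => ω.1 i) (fun ω => ω.2.2 i)
      (fun ω => ω.2.1) = ENNReal.ofReal (1 / 2 * Real.logb 2 (a / E)) := by
  refine condMutualInfo_eq (g := fun u => u i) (by fun_prop) (by fun_prop) (by fun_prop)
    (by fun_prop) ha0 hE0 (map_error_cacheChannel hE i) (map_cacheError_cacheChannel ha i) ?_ ?_
  · intro F hF
    have hG' : Measurable fun ω : EuclideanSpace ℝ (Fin 2) × (Fin 2 → ℝ) ×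
        EuclideanSpace ℝ (Fin 2) => ∫⁻ x, F (ω.2.1, x, ω.2.2 i) ∂(gaussianReal (ω.2.2 i) E) :=
      measurable_lintegral_gaussianReal (by fun_prop : Measurable fun ω : EuclideanSpace ℝ (Fin 2) ×
        (Fin 2 → ℝ) × EuclideanSpace ℝ (Fin 2) => ω.2.2 i) E
        (F := fun ω x => F (ω.2.1, x, ω.2.2 i)) (by fun_prop)
    have hF' : Measurable fun ω : EuclideanSpace ℝ (Fin 2) × (Fin 2 → ℝ) ×
        EuclideanSpace ℝ (Fin 2) => F (ω.2.1, ω.1 i, ω.2.2 i) := by fun_prop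
    rw [cacheChannel, lintegral_map hF' measurable_cacheChannel,
      lintegral_map hG' measurable_cacheChannel]
    refine (lintegral_prod _ (hF'.comp measurable_cacheChannel).aemeasurable).trans
      (Eq.trans ?_ (lintegral_prod _ (hG'.comp measurable_cacheChannel).aemeasurable).symm)
    refine lintegral_congr fun p => ?_
    have hp : Measurable fun r : (ℝ × ℝ) × ℝ × ℝ => (p, r) := by fun_prop
    refine (lintegral_prod _ (hF'.comp (measurable_cacheChannel.comp hp)).aemeasurable).trans
      (Eq.trans ?_ (lintegral_prod _ (hG'.comp (measurable_cacheChannel.comp hp)).aemeasurable).symm)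
    refine lintegral_congr fun r => ?_
    simp only [Function.comp, rotation_add_apply, lintegral_const, measure_univ, mul_one,
      ← add_assoc]
    exact lintegral_gaussianPair_rotation_apply hE i (rotation p i + rotation r i)
      (F := fun x => F (rotationTuple p, x, rotation p i + rotation r i)) (by fun_prop)
  · intro F hF
    have hG' : Measurable fun ω : EuclideanSpace ℝ (Fin 2) × (Fin 2 → ℝ) ×
        EuclideanSpace ℝ (Fin 2) => ∫⁻ x, F (ω.2.1, x) ∂(gaussianReal (ω.2.1 i) a) :=
      measurable_lintegral_gaussianReal (by fun_prop : Measurable fun ω : EuclideanSpace ℝ (Fin 2) ×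
        (Fin 2 → ℝ) × EuclideanSpace ℝ (Fin 2) => ω.2.1 i) a
        (F := fun ω x => F (ω.2.1, x)) (by fun_prop)
    have hF' : Measurable fun ω : EuclideanSpace ℝ (Fin 2) × (Fin 2 → ℝ) ×
        EuclideanSpace ℝ (Fin 2) => F (ω.2.1, ω.1 i) := by fun_prop
    rw [cacheChannel, lintegral_map hF' measurable_cacheChannel,
      lintegral_map hG' measurable_cacheChannel]
    refine (lintegral_prod _ (hF'.comp measurable_cacheChannel).aemeasurable).trans
      (Eq.trans ?_ (lintegral_prod _ (hG'.comp measurable_cacheChannel).aemeasurable).symm)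
    refine lintegral_congr fun p => ?_
    simp only [Function.comp, lintegral_const, measure_univ, mul_one]
    have hH : Measurable fun r : ℝ × ℝ => F (rotationTuple p, rotation p i + rotation r i) := by
      fun_prop
    have e := lintegral_map (μ := (gaussianPair m n).prod (gaussianPair z y)) hH
      (by fun_prop : Measurable fun r : (ℝ × ℝ) × ℝ × ℝ => r.1 + r.2)
    rw [map_add_prod_gaussianPair, lintegral_gaussianPair_rotation_apply ha i (rotation p i)
      (F := fun x => F (rotationTuple p, x)) (by fun_prop)] at e
    simp only [rotation_add_apply] at e ⊢
    exact e.symm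

end Channel

/-- Achievability: caching a Gaussian description with error variances `k`, `l` in rotated
coordinates, followed by a refinement down to distortion `E`. -/
theorem rdcFunction_le {ρ k l E : ℝ} {D C : ℝ≥0} (hk : 0 < k) (hl : 0 < l) (hkρ : k ≤ 1 + ρ)
    (hlρ : l ≤ 1 - ρ) (hE : 0 < E) (hEkl : 2 * E ≤ k + l) (hED : E ≤ D)
    (hC : 1 / 2 * Real.logb 2 ((1 - ρ ^ 2) / (k * l)) ≤ C) :
    rdcFunction (bivariateGaussian ρ) (fun _ => D) C ≤
      ENNReal.ofReal (1 / 2 * Real.logb 2 ((k + l) / 2 / E)) := by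
  have hr1 : 2 * E / (k + l) ≤ 1 := by
    rw [div_le_one (by linarith)]
    exact hEkl
  have hr0 : 0 < 2 * E / (k + l) := by positivity
  -- The cache error `(k, l)` is split in proportion `r` into the final error `(z, y)` and the part
  -- `(m, n)` removed by the refinement. The split has nonnegative variances because `2E ≤ k + l`,
  -- and it gives `z + y = 2E`.
  set r := 2 * E / (k + l) with hr
  obtain ⟨s, hs⟩ : ∃ s : ℝ≥0, (s : ℝ) = 1 + ρ - k := ⟨⟨1 + ρ - k, by linarith⟩, rfl⟩
  obtain ⟨t, ht⟩ : ∃ t : ℝ≥0, (t : ℝ) = 1 - ρ - l := ⟨⟨1 - ρ - l, by linarith⟩, rfl⟩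
  obtain ⟨z, hz⟩ : ∃ z : ℝ≥0, (z : ℝ) = r * k := ⟨⟨r * k, by positivity⟩, rfl⟩
  obtain ⟨y, hy⟩ : ∃ y : ℝ≥0, (y : ℝ) = r * l := ⟨⟨r * l, by positivity⟩, rfl⟩
  obtain ⟨m, hm⟩ : ∃ m : ℝ≥0, (m : ℝ) = (1 - r) * k :=
    ⟨⟨(1 - r) * k, mul_nonneg (by linarith) hk.le⟩, rfl⟩
  obtain ⟨n, hn⟩ : ∃ n : ℝ≥0, (n : ℝ) = (1 - r) * l :=
    ⟨⟨(1 - r) * l, mul_nonneg (by linarith) hl.le⟩, rfl⟩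
  obtain ⟨a, ha⟩ : ∃ a : ℝ≥0, (a : ℝ) = (k + l) / 2 := ⟨⟨(k + l) / 2, by positivity⟩, rfl⟩
  lift E to ℝ≥0 using hE.le
  have hmz : ((m + z : ℝ≥0) : ℝ) = k := by
    push_cast
    rw [hm, hz]
    ring
  have hny : ((n + y : ℝ≥0) : ℝ) = l := by
    push_cast
    rw [hn, hy]
    ring
  have hv : ((s + (m + z) : ℝ≥0) : ℝ) = 1 + ρ := by
    rw [NNReal.coe_add, hmz, hs]
    ring
  have hw : ((t + (n + y) : ℝ≥0) : ℝ) = 1 - ρ := by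
    rw [NNReal.coe_add, hny, ht]
    ring
  have hzy : (z : ℝ) + y = 2 * E := by
    rw [hz, hy, hr]
    field_simp
  have hE0 : E ≠ 0 := by simpa using hE.ne'
  have ha0 : a ≠ 0 := by
    rw [← NNReal.coe_ne_zero, ha]
    positivity
  have hmz0 : m + z ≠ 0 := by
    rw [← NNReal.coe_ne_zero, hmz]
    exact hk.ne'
  have hny0 : n + y ≠ 0 := by
    rw [← NNReal.coe_ne_zero, hny]
    exact hl.ne'
  refine iInf_le_of_le 2 (iInf_le_of_le (cacheChannel s t m n z y) (iInf_le_of_le inferInstance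
    (iInf_le_of_le ?_ (iInf₂_le_of_le ?_ ?_ ?_))))
  · rw [map_fst_cacheChannel, bivariateGaussian_eq_map_rotation hv hw]
  · refine (mutualInfo_cacheChannel_le hmz0 hny0).trans ?_
    rw [hv, hw, hmz, hny, ← ENNReal.ofReal_coe_nnreal]
    refine ENNReal.ofReal_le_ofReal (le_of_eq_of_le ?_ hC)
    ring_nf
  · intro i
    rw [meanSqError_eq (D := E) (by fun_prop) (by fun_prop) (map_error_cacheChannel hzy i)]
    exact_mod_cast hED
  · refine iSup_le fun i => le_of_eq ?_
    rw [condMutualInfo_cacheChannel (by rw [hmz, hny, ha]; ring) hzy ha0 hE0, ha]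

/-! ### The regions and the three formulas -/

section Regions

variable {ρ : ℝ} {D C : ℝ≥0}

theorem le_of_ofReal_le_coe {x : ℝ} (h : ENNReal.ofReal x ≤ (C : ℝ≥0∞)) : x ≤ C := by
  rw [← ENNReal.ofReal_coe_nnreal] at h
  exact (ENNReal.ofReal_le_ofReal_iff C.coe_nonneg).1 h

theorem le_of_coe_le_ofReal {x : ℝ} (hx : 0 ≤ x) (h : (C : ℝ≥0∞) ≤ ENNReal.ofReal x) :
    (C : ℝ) ≤ x := by
  rw [← ENNReal.ofReal_coe_nnreal] at h
  exact (ENNReal.ofReal_le_ofReal_iff hx).1 h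

/-- A rate bound `C ≤ log x / 2` in exponential form. -/
theorem inv_le_two_rpow {x : ℝ} (hx : 0 < x) (h : (C : ℝ) ≤ 1 / 2 * Real.logb 2 x) :
    x⁻¹ ≤ (2 : ℝ) ^ (-2 * (C : ℝ)) := by
  have h1 : (2 : ℝ) ^ (2 * (C : ℝ)) ≤ x := by
    rw [← Real.le_logb_iff_rpow_le (by norm_num) hx]
    linarith
  rw [neg_mul, Real.rpow_neg (by norm_num)]
  exact inv_anti₀ (by positivity) h1

/-- The cached description alone already attains distortion `E`, so the refinement has rate `log 1 =
0`. -/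
theorem rdcFunction_eq_zero {k l E : ℝ} (hk : 0 < k) (hl : 0 < l) (hkρ : k ≤ 1 + ρ)
    (hlρ : l ≤ 1 - ρ) (hE : k + l = 2 * E) (hED : E ≤ D)
    (hC : 1 / 2 * Real.logb 2 ((1 - ρ ^ 2) / (k * l)) ≤ C) :
    rdcFunction (bivariateGaussian ρ) (fun _ => D) C = 0 := by
  have hE0 : 0 < E := by linarith
  refine le_antisymm ((rdcFunction_le hk hl hkρ hlρ hE0 hE.ge hED hC).trans_eq ?_) zero_le
  rw [hE, mul_div_cancel_left₀ _ (by norm_num : (2 : ℝ) ≠ 0), div_self hE0.ne']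
  simp

theorem rdcFunction_eq_zero_of_mem_regionS1 (hρ0 : 0 < ρ) (hρ1 : ρ < 1) (hD : 0 < D)
    (h : (D, C) ∈ regionS1 ρ) : rdcFunction (bivariateGaussian ρ) (fun _ => D) C = 0 := by
  have h' : jointRD (bivariateGaussian ρ) (fun _ => D) ≤ C := h
  have hD' : (0 : ℝ) < D := hD
  rcases le_total (D : ℝ) (1 - ρ) with hDρ | hDρ
  · refine rdcFunction_eq_zero hD' hD' (by linarith) hDρ (two_mul (D : ℝ)).symm le_rfl ?_
    rw [← sq]
    exact le_of_ofReal_le_coe ((ofReal_le_jointRD hρ0 hρ1 hD).trans h')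
  rcases le_total (D : ℝ) 1 with hD1 | hD1
  · have hz : 0 < 2 * (D : ℝ) - (1 - ρ) := by linarith
    refine rdcFunction_eq_zero (k := 2 * D - (1 - ρ)) (l := 1 - ρ) (E := D) hz (by linarith)
      (by linarith) le_rfl (by ring) le_rfl ?_
    have : (1 - ρ ^ 2) / ((2 * D - (1 - ρ)) * (1 - ρ)) = (1 + ρ) / (2 * (D : ℝ) - (1 - ρ)) := by
      have : 1 - ρ ≠ 0 := by linarith
      field_simp
      ring
    rw [this]
    exact le_of_ofReal_le_coe ((ofReal_le_jointRD_of_le hρ0 hρ1 hDρ).trans h')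
  -- For `D ≥ 1` the error variances equal those of the source: nothing is cached or sent, at cost
  -- zero.
  · refine rdcFunction_eq_zero (k := 1 + ρ) (l := 1 - ρ) (E := 1) (by linarith) (by linarith)
      le_rfl le_rfl (by ring) hD1 ?_
    have : (1 - ρ ^ 2) / ((1 + ρ) * (1 - ρ)) = 1 := by
      rw [div_eq_one_iff_eq (by nlinarith)]
      ring
    rw [this]
    simp

/-- For `D > 1 - ρ` the joint rate is strictly below the common information, which would leave no
room for `C`. -/
theorem le_one_sub_of_mem_regionS2 (hρ0 : 0 < ρ) (hρ1 : ρ < 1) (h : (D, C) ∈ regionS2 ρ) :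
    (D : ℝ) ≤ 1 - ρ := by
  by_contra! hDρ
  have hle : wynerCI (bivariateGaussian ρ) ≤ jointRD (bivariateGaussian ρ) (fun _ => D) :=
    le_trans h.1 h.2
  obtain ⟨k, hk1, hk2, hk3⟩ : ∃ k : ℝ, 1 - ρ < k ∧ k ≤ 1 + ρ ∧ k ≤ 2 * D - (1 - ρ) :=
    -- The sum component takes the error budget left by the difference component, capped at its own
    -- variance `1 + ρ`.
    ⟨min (1 + ρ) (2 * D - (1 - ρ)), lt_min (by linarith) (by linarith), min_le_left _ _,
      min_le_right _ _⟩
  have hk0 : 0 < k := by linarith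
  have hJ := jointRD_le (ρ := ρ) (D := D) (k := k) (l := 1 - ρ) hk0 (by linarith) hk2 le_rfl
    (by linarith)
  have h1 := (ofReal_le_wynerCI hρ0 hρ1).trans (hle.trans hJ)
  have : (1 - ρ ^ 2) / (k * (1 - ρ)) = (1 + ρ) / k := by
    have : 1 - ρ ≠ 0 := by linarith
    field_simp
    ring
  rw [this, ENNReal.ofReal_le_ofReal_iff (mul_nonneg (by norm_num)
    (Real.logb_nonneg (by norm_num) (by rw [le_div_iff₀ hk0]; linarith)))] at h1
  have h2 : Real.logb 2 ((1 + ρ) / k) < Real.logb 2 ((1 + ρ) / (1 - ρ)) :=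
    Real.logb_lt_logb (by norm_num) (div_pos (by linarith) hk0)
      (div_lt_div_of_pos_left (by linarith) (by linarith) hk1)
  linarith

theorem rdcFunction_eq_of_mem_regionS2 (hρ0 : 0 < ρ) (hρ1 : ρ < 1) (hD : 0 < D)
    (h : (D, C) ∈ regionS2 ρ) :
    (rdcFunction (bivariateGaussian ρ) (fun _ => D) C : EReal) =
      ((1 / 4 * Real.logb 2 ((1 - ρ ^ 2) / (D : ℝ) ^ 2) - (C : ℝ) / 2 : ℝ) : EReal) := by
  have hD' : (0 : ℝ) < D := hD
  have hDρ := le_one_sub_of_mem_regionS2 hρ0 hρ1 h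
  have hρ2 : 0 < 1 - ρ ^ 2 := by nlinarith
  have hCW := le_of_ofReal_le_coe ((ofReal_le_wynerCI hρ0 hρ1).trans h.1)
  have hge : 1 ≤ (1 - ρ ^ 2) / (D : ℝ) ^ 2 := by
    rw [le_div_iff₀ (by positivity)]
    nlinarith
  have hCJ : (C : ℝ) ≤ 1 / 2 * Real.logb 2 ((1 - ρ ^ 2) / (D : ℝ) ^ 2) := by
    have hJ := h.2.trans (jointRD_le (ρ := ρ) hD' hD' (by linarith) hDρ (two_mul (D : ℝ)).ge)
    rw [← sq] at hJ
    exact le_of_coe_le_ofReal (mul_nonneg (by norm_num) (Real.logb_nonneg (by norm_num) hge)) hJ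
  have hnonneg : 0 ≤ 1 / 4 * Real.logb 2 ((1 - ρ ^ 2) / (D : ℝ) ^ 2) - (C : ℝ) / 2 := by linarith
  suffices hs : rdcFunction (bivariateGaussian ρ) (fun _ => D) C =
      ENNReal.ofReal (1 / 4 * Real.logb 2 ((1 - ρ ^ 2) / (D : ℝ) ^ 2) - (C : ℝ) / 2) by
    rw [hs, EReal.coe_ennreal_ofReal, max_eq_left hnonneg]
  refine le_antisymm ?_ (ofReal_le_rdcFunction hρ0 hρ1 hD)
  -- Equal error variances `k = l = a` that exhaust the cache exactly: `(1 - ρ²) / a² = 2^(2C)`. The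
  -- bound `C ≥ K_W` is what gives `a ≤ 1 - ρ`, so that the channel exists, and `C ≤ R(D, D)` gives
  -- `D ≤ a`.
  set a : ℝ := √(1 - ρ ^ 2) * 2 ^ (-(C : ℝ)) with ha
  have ha0 : 0 < a := by positivity
  have hla : Real.logb 2 a = 1 / 2 * Real.logb 2 (1 - ρ ^ 2) - C := by
    rw [ha, Real.logb_mul (by positivity) (by positivity), Real.logb_rpow (by norm_num) (by norm_num),
      Real.sqrt_eq_rpow, Real.logb_rpow_eq_mul_logb_of_pos hρ2]
    ring
  have hlD : Real.logb 2 ((1 - ρ ^ 2) / (D : ℝ) ^ 2) =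
      Real.logb 2 (1 - ρ ^ 2) - 2 * Real.logb 2 D := by
    rw [Real.logb_div hρ2.ne' (by positivity), Real.logb_pow]
    push_cast
    ring
  have hDa : (D : ℝ) ≤ a := by
    rw [← Real.logb_le_logb (b := 2) (by norm_num) hD' ha0, hla]
    rw [hlD] at hCJ
    linarith
  have haρ : a ≤ 1 - ρ := by
    rw [← Real.logb_le_logb (b := 2) (by norm_num) ha0 (by linarith), hla]
    have h1 : (1 - ρ ^ 2) = (1 + ρ) * (1 - ρ) := by ring
    rw [Real.logb_div (by linarith) (by linarith)] at hCW
    rw [h1, Real.logb_mul (by linarith) (by linarith)]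
    linarith
  refine (rdcFunction_le ha0 ha0 (by linarith) haρ hD' (by linarith) le_rfl (le_of_eq ?_)).trans_eq
    (congrArg ENNReal.ofReal ?_)
  · rw [← sq, Real.logb_div hρ2.ne' (by positivity), Real.logb_pow, hla]
    push_cast
    ring
  · rw [add_self_div_two, Real.logb_div ha0.ne' hD'.ne', hla, hlD]
    ring

/-- The right side is the average of `(1 + ρ) 2^(-2C)` and `1 - ρ`, the per-coordinate error when
the cache describes only the sum component. The upper bounds on `C` defining the regions keep
`2^(-2C)` large enough for this error to be at least `D`. -/
theorem le_cacheError_of_mem (hρ0 : 0 < ρ) (hρ1 : ρ < 1) (h : (D, C) ∈ regionS3 ρ ∪ regionS4 ρ) :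
    (D : ℝ) ≤ 1 - 1 / 2 * (1 + ρ) * (1 - (2 : ℝ) ^ (-2 * (C : ℝ))) := by
  have h1ρ : 0 < 1 - ρ := by linarith
  have h1ρ' : 0 < 1 + ρ := by linarith
  rcases h with ⟨hD, hC⟩ | ⟨hD, hD1, hC⟩
  · have hge : 1 ≤ (1 + ρ) / (1 - ρ) := by
      rw [le_div_iff₀ h1ρ]
      linarith
    have h1 := inv_le_two_rpow (by positivity) (le_of_coe_le_ofReal
      (mul_nonneg (by norm_num) (Real.logb_nonneg (by norm_num) hge)) (hC.trans (wynerCI_le hρ0 hρ1)))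
    rw [inv_div, div_le_iff₀ h1ρ'] at h1
    linarith
  · have hz : 0 < 2 * (D : ℝ) - (1 - ρ) := by linarith
    have hge : 1 ≤ (1 + ρ) / (2 * (D : ℝ) - (1 - ρ)) := by
      rw [le_div_iff₀ hz]
      linarith
    have hJ := hC.trans (jointRD_le (ρ := ρ) (D := D) (k := 2 * D - (1 - ρ)) (l := 1 - ρ) hz h1ρ
      (by linarith) le_rfl (by linarith))
    have : (1 - ρ ^ 2) / ((2 * D - (1 - ρ)) * (1 - ρ)) = (1 + ρ) / (2 * (D : ℝ) - (1 - ρ)) := by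
      field_simp
      ring
    rw [this] at hJ
    have h1 := inv_le_two_rpow (by positivity) (le_of_coe_le_ofReal
      (mul_nonneg (by norm_num) (Real.logb_nonneg (by norm_num) hge)) hJ)
    rw [inv_div, div_le_iff₀ h1ρ'] at h1
    linarith

theorem rdcFunction_le_of_mem (hρ0 : 0 < ρ) (hρ1 : ρ < 1) (hD : 0 < D)
    (h : (D, C) ∈ regionS3 ρ ∪ regionS4 ρ) :
    (rdcFunction (bivariateGaussian ρ) (fun _ => D) C : EReal) ≤
      ((1 / 2 * Real.logb 2
        ((1 - 1 / 2 * (1 + ρ) * (1 - (2 : ℝ) ^ (-2 * (C : ℝ)))) / (D : ℝ)) : ℝ) : EReal) := by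
  have hD' : (0 : ℝ) < D := hD
  have hDa := le_cacheError_of_mem hρ0 hρ1 h
  set q : ℝ := (2 : ℝ) ^ (-2 * (C : ℝ)) with hq
  have hq0 : 0 < q := by positivity
  have hq1 : q ≤ 1 := Real.rpow_le_one_of_one_le_of_nonpos (by norm_num)
    (by linarith [C.coe_nonneg])
  have hle := rdcFunction_le (ρ := ρ) (k := (1 + ρ) * q) (l := 1 - ρ) (E := D) (D := D) (C := C)
    (by positivity) (by linarith) (mul_le_of_le_one_right (by linarith) hq1) le_rfl hD'
    (by linarith) le_rfl (by
      have h1 : (1 - ρ ^ 2) / ((1 + ρ) * q * (1 - ρ)) = q⁻¹ := by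
        have : 1 - ρ ≠ 0 := by linarith
        have : 1 + ρ ≠ 0 := by linarith
        field_simp
        ring
      rw [h1, Real.logb_inv, hq, Real.logb_rpow (by norm_num) (by norm_num)]
      linarith)
  have h2 : ((1 + ρ) * q + (1 - ρ)) / 2 = 1 - 1 / 2 * (1 + ρ) * (1 - q) := by ring
  rw [h2] at hle
  refine (EReal.coe_ennreal_le_coe_ennreal_iff.2 hle).trans_eq ?_
  -- The cache error is at least `D`, so the logarithm is nonnegative and truncation at zero loses
  -- nothing.
  rw [EReal.coe_ennreal_ofReal, max_eq_left]
  exact mul_nonneg (by norm_num) (Real.logb_nonneg (by norm_num)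
    (by rw [le_div_iff₀ hD']; linarith))

end Regions

end RDC

theorem mainTheorem9 (ρ : ℝ) (hρ0 : 0 < ρ) (hρ1 : ρ < 1) (D C : ℝ≥0) (hD : 0 < D) :
    ((D, C) ∈ RDC.regionS1 ρ →
      RDC.rdcFunction (RDC.bivariateGaussian ρ) (fun _ => D) C = 0) ∧
    ((D, C) ∈ RDC.regionS2 ρ →
      (RDC.rdcFunction (RDC.bivariateGaussian ρ) (fun _ => D) C : EReal) =
        ((1 / 4 * Real.logb 2 ((1 - ρ ^ 2) / (D : ℝ) ^ 2) - (C : ℝ) / 2 : ℝ) : EReal)) ∧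
    ((D, C) ∈ RDC.regionS3 ρ ∪ RDC.regionS4 ρ →
      (RDC.rdcFunction (RDC.bivariateGaussian ρ) (fun _ => D) C : EReal) ≤
        ((1 / 2 * Real.logb 2
          ((1 - 1 / 2 * (1 + ρ) * (1 - (2 : ℝ) ^ (-2 * (C : ℝ)))) / (D : ℝ)) : ℝ) : EReal)) :=
  ⟨RDC.rdcFunction_eq_zero_of_mem_regionS1 hρ0 hρ1 hD,
    RDC.rdcFunction_eq_of_mem_regionS2 hρ0 hρ1 hD, RDC.rdcFunction_le_of_mem hρ0 hρ1 hD⟩
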